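/- **Setting.** Consider dynamic networks $w=G(q,\theta)w+Rr+H(q,\theta)\tilde e$ with $L$ internal signals $w=(w_1,\dots,w_L)$, $K$ excitation signals $r$ and white noise $\tilde e$ with covariance matrix $\tilde\Lambda(\theta)$. A set $\mathcal C$ of internal signals, of size $c$, is measured: $w_{\mathcal C}=Cw$. $C$ consists of rows, and $R$ of $K$ distinct columns, of the identity matrix. $H=\begin{bmatrix}\tilde H\\0\end{bmatrix}$, with the $c\times c$ block $\tilde H$ in the measured rows and zeros in the unmeasured rows. A model set $\mathcal M$ is the set of these models for $\theta\in\Theta\subseteq\mathbb R^n$. The entries of $G$ and $\tilde H$ are quotients of polynomials in $q$ whose coefficients are polynomials in $\theta$. For every $\theta\in\Theta$: $G$ is proper, stable and has zero diagonal; $T=(I-G)^{-1}$ is stable; all principal minors of $\lim_{z\to\infty}(I-G(z))$ are nonzero; $\tilde H$ is proper, stable, monic ($\tilde H(\infty)=I$) and minimum phase; $\tilde\Lambda$ is real positive semidefinite. (Stable: all poles in $|z|<1$. Minimum phase, for a square matrix: invertible, and the inverse has no poles in $|z|>1$.) Let $X=[R\ \ H]$ and $\Phi(\omega)=TH\tilde\Lambda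 H^*T^*$ evaluated at $q=e^{i\omega}$. Assume: * (full rank) for every $\theta\in\Theta$, $C\Phi(\omega)C^\top$ has full rank for almost all $\omega$; * (independence) no two entries of $G$ and $\tilde H$ share a parameter; * (feedthrough) either $G$ is strictly proper for all $\theta\in\Theta$, or $\tilde\Lambda$ is diagonal for all $\theta\in\Theta$ and there is a permutation matrix $P$ such that $P\,G(\infty,\theta)\,P^\top$ is lower triangular for all $\theta\in\Theta$; * (fixed entries) every submatrix of $[(G-I)\ \ X]$ that does not depend on $\theta$ has rank equal to its structural rank, i.e. the maximal rank of the matrices with the same nonzero pattern. **Graph.** The vertices are all internal signals $w_a$ and all external signals (those in $r$ and $\tilde e$). An entry of $[G\ \ X]$ gives an edge from its column signal to its row signal unless it is zero for all $\theta\in\Theta$; the edge is known if the entry does not depend on $\theta$. Paths are directed and repeat no vertex; a single vertex is a path. A set $D$ of vertices is an $A-B$ disconnecting set if it meets every path from $A$ to $B$. Let * $\mathcal N_j^-$ be the internal in-neighbors of $w_j$, except the measured ones that have a known edge to $w_j$; * $\mathcal N_i^*$ be all internal in-neighbors of $w_i$; * $\mathcal N_i^+$ be the out-neighbors of $w_i$,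 except those $w_m$ such that the edge $(w_i,w_m)$ is known and $w_m$ is excited by an external signal of out-degree one whose out-going edge is known. Call $w_a$ excited by $r$ if some component of $r$ has its edge into $w_a$. (Distinct signals are then excited by distinct components.) For a set $A$ of internal signals, a suitable indirect measurement of $w_j$ relative to $A$ is a $w_k\in\mathcal C\setminus\{w_j\}$ such that $\mathcal D$ is also an $A-\{w_k\}$ disconnecting set and there is a path from $w_j$ to $w_k$ that avoids $\mathcal D$. **Theorem.** Let $\mathcal M$ be a model set as above, let $w_i,w_j$ be internal signals, and let $\mathcal D$ be a set of internal signals. Suppose that one of the following cases holds in $\mathcal M$, i.e. in the model set obtained after the allocation. 1. ($w_i,w_j$ measured.) $\mathcal D$ is a $\{w_i\}-\mathcal N_j^-\setminus\{w_i\}$ disconnecting set with $w_i\notin\mathcal D$; all of $\mathcal D\cup\{w_i\}$ is excited by $r$; all of $\mathcal D\cup\{w_i,w_j\}$ is measured. 2. ($w_i,w_j$ excited.) $\mathcal D$ is an $\mathcal N_i^+\setminus\{w_j\}-\{w_j\}$ disconnecting set with $w_j\notin\mathcal D$; all of $\mathcal D\cup\{w_i,w_j\}$ is excited by $r$; all of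 $\mathcal D$ is measured; and $w_j$ is measured or has a suitable indirect measurement relative to $\mathcal N_i^+\setminus\{w_j\}$. 3. ($w_i$ unmeasured, $w_j$ measured.) $\mathcal D$ is a $\{w_i\}-\mathcal N_i^*\cup(\mathcal N_j^-\setminus\{w_i\})$ disconnecting set with $w_i\notin\mathcal D$; all of $\mathcal D\cup\{w_i\}$ is excited by $r$; all of $\mathcal D\cup\{w_j\}$ is measured. 4. ($w_i$ measured, $w_j$ unmeasured.) $\mathcal D$ is an $(\mathcal N_i^+\setminus\{w_j\})\cup\{w_i\}-\{w_i,w_j\}$ disconnecting set with $w_j\notin\mathcal D$ (so $w_i\in\mathcal D$); all of $\mathcal D\cup\{w_j\}$ is excited by $r$; all of $\mathcal D$ is measured; and $w_j$ has a suitable indirect measurement relative to $(\mathcal N_i^+\setminus\{w_j\})\cup\{w_i\}$. In Cases 2 and 4, if some out-neighbor of $w_i$ that is left out of $\mathcal N_i^+$ is not excited by $r$ (so that it is left out only because of a noise signal), suppose in addition that $CTH$ is minimum phase for every $\theta\in\Theta$. Then $G_{ji}$ is generically identifiable in $\mathcal M$ from $(w_{\mathcal C},r)$: for almost all $\theta_0\in\Theta$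 (Lebesgue) and for all $\theta_1\in\Theta$, if $CT(q,\theta_0)R=CT(q,\theta_1)R$ and $C\Phi(\omega,\theta_0)C^\top=C\Phi(\omega,\theta_1)C^\top$ for all $\omega$, then $G_{ji}(q,\theta_0)=G_{ji}(q,\theta_1)$. -/

import Mathlib

open MeasureTheory Polynomial

noncomputable section

namespace DynNet

/-! ### Rational transfer functions in the variable `z` (shift operator `q`) -/

/-- A rational transfer function is proper when it has a finite limit at `z = ∞`. -/
def IsProper (f : RatFunc ℝ) : Prop := f.intDegree ≤ 0

/-- Strictly proper: the limit at `z = ∞` is zero. -/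
def IsStrictlyProper (f : RatFunc ℝ) : Prop := f = 0 ∨ f.intDegree < 0

/-- Stable: all (complex) poles lie in the open unit disc. -/
def IsStable (f : RatFunc ℝ) : Prop :=
  ∀ z : ℂ, Polynomial.aeval z f.denom = 0 → ‖z‖ < 1

/-- The limit at `z = ∞` of a proper rational function (recall that `RatFunc.denom` is monic). -/
def limInf (f : RatFunc ℝ) : ℝ := f.num.coeff f.denom.natDegree

/-- Minimum phase: a square, invertible transfer matrix without zeros outside the closed
unit disc, i.e. whose inverse has no pole of modulus larger than one. -/
def IsMinPhase {ι : Type} [Fintype ι] [DecidableEq ι] (A : Matrix ι ι (RatFunc ℝ)) : Prop :=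
  A.det ≠ 0 ∧ ∀ a b, ∀ z : ℂ, Polynomial.aeval z (A⁻¹ a b).denom = 0 → ‖z‖ ≤ 1

/-- The complex matrix `A(z)` at a point `z` that is not a pole of `A`. -/
def evalAt {ι κ : Type} (A : Matrix ι κ (RatFunc ℝ)) (z : ℂ) : Matrix ι κ ℂ :=
  A.map (RatFunc.eval (algebraMap ℝ ℂ) z)

/-- The structural rank: the maximal rank among all matrices with the same nonzero pattern. -/
def structuralRank {ι κ : Type} [Fintype ι] [Fintype κ] (A : Matrix ι κ (RatFunc ℝ)) : ℕ :=
  sSup {r | ∃ B : Matrix ι κ (RatFunc ℝ), (∀ a b, B a b = 0 ↔ A a b = 0) ∧ B.rank = r}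

/-! ### Rationally parameterized transfer functions -/

/-- A transfer function in rational form: a quotient of two polynomials in `z` whose
coefficients are polynomials in the parameters `θ ∈ ℝⁿ`. -/
structure ParamTF (n : ℕ) where
  num : (MvPolynomial (Fin n) ℝ)[X]
  den : (MvPolynomial (Fin n) ℝ)[X]

namespace ParamTF

variable {n : ℕ}

/-- The denominator polynomial in `z` at the parameter value `θ`. -/
def denAt (f : ParamTF n) (θ : Fin n → ℝ) : ℝ[X] := f.den.map (MvPolynomial.eval θ)

/-- The transfer function at the parameter value `θ`. -/
def eval (f : ParamTF n) (θ : Fin n → ℝ) : RatFunc ℝ :=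
  algebraMap ℝ[X] (RatFunc ℝ) (f.num.map (MvPolynomial.eval θ)) /
    algebraMap ℝ[X] (RatFunc ℝ) (f.denAt θ)

/-- The (indices of the) parameters that occur in the rational form. -/
def params (f : ParamTF n) : Set (Fin n) :=
  {k | ∃ d, k ∈ (f.num.coeff d).vars ∨ k ∈ (f.den.coeff d).vars}

end ParamTF

/-! ### Paths and disconnecting sets in a directed graph -/

/-- `p` lists the vertices of a directed path from `a` to `b` (no repeated vertex; a single
vertex is a path to itself). -/
def IsPath {V : Type} (E : V → V → Prop) (a b : V) (p : List V) : Prop :=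
  p.head? = some a ∧ p.getLast? = some b ∧ p.IsChain E ∧ p.Nodup

/-- `D` meets every directed path from `A` to `B`. -/
def IsDisconnecting {V : Type} (E : V → V → Prop) (D A B : Set V) : Prop :=
  ∀ a ∈ A, ∀ b ∈ B, ∀ p, IsPath E a b p → ∃ d ∈ D, d ∈ p

/-! ### Network model sets -/

/-- The vertices of a network with `L` internal signals `w`, `K` excitation signals `r` and
noise signals `ẽ` indexed by the measured signals. -/
abbrev Vertex (L K : ℕ) (C : Finset (Fin L)) : Type := Fin L ⊕ (Fin K ⊕ C)

/-- The vertex of an internal signal. -/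
abbrev internal {L K : ℕ} {C : Finset (Fin L)} (a : Fin L) : Vertex L K C := Sum.inl a

/-- The vertex of an external signal. -/
abbrev external {L K : ℕ} {C : Finset (Fin L)} (x : Fin K ⊕ C) : Vertex L K C := Sum.inr x

/-- The data of a parameterized family of network models
`w = G w + R r + H ẽ`, `H = [H̃; 0]`, `cov ẽ = Λ`, with measured signals `C`. -/
structure ModelData (L K n : ℕ) where
  /-- the parameter set -/
  Θ : Set (Fin n → ℝ)
  /-- the set of measured internal signals -/
  C : Finset (Fin L)
  /-- `r p` directly excites `w (ρ p)`; `R` consists of `K` columns of the identity matrix -/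
  ρ : Fin K ↪ Fin L
  /-- the rational forms of the entries of `G` -/
  Gform : Fin L → Fin L → ParamTF n
  /-- the rational forms of the entries of `H̃` -/
  Hform : C → C → ParamTF n
  /-- the noise covariance matrix -/
  Λ : (Fin n → ℝ) → Matrix C C ℝ

namespace ModelData

variable {L K n : ℕ} (M : ModelData L K n)

/-- `G(q, θ)`. -/
def G (θ : Fin n → ℝ) : Matrix (Fin L) (Fin L) (RatFunc ℝ) :=
  Matrix.of fun a b => (M.Gform a b).eval θ

/-- `H̃(q, θ)`. -/
def Htilde (θ : Fin n → ℝ) : Matrix M.C M.C (RatFunc ℝ) :=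
  Matrix.of fun a b => (M.Hform a b).eval θ

/-- `H(q, θ)`: `H̃` in the measured rows, zero in the unmeasured ones. -/
def H (θ : Fin n → ℝ) : Matrix (Fin L) M.C (RatFunc ℝ) :=
  Matrix.of fun a c => if h : a ∈ M.C then M.Htilde θ ⟨a, h⟩ c else 0

/-- The binary matrix `R`. -/
def R : Matrix (Fin L) (Fin K) (RatFunc ℝ) :=
  Matrix.of fun a p => if M.ρ p = a then 1 else 0

/-- `X(q, θ) = [R  H]`. -/
def X (θ : Fin n → ℝ) : Matrix (Fin L) (Fin K ⊕ M.C) (RatFunc ℝ) :=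
  Matrix.fromCols M.R (M.H θ)

/-- `G^∞(θ)`, the limit of `G(z, θ)` as `z → ∞`. -/
def Ginf (θ : Fin n → ℝ) : Matrix (Fin L) (Fin L) ℝ := (M.G θ).map limInf

/-- `T(q, θ) = (I - G)⁻¹`. -/
def T (θ : Fin n → ℝ) : Matrix (Fin L) (Fin L) (RatFunc ℝ) := (1 - M.G θ)⁻¹

/-- `C A`: the measured rows of a matrix `A`. -/
def measuredRows {κ S : Type} (A : Matrix (Fin L) κ S) : Matrix M.C κ S :=
  A.submatrix Subtype.val id

/-- `C T(q, θ) R`. -/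
def CTR (θ : Fin n → ℝ) : Matrix M.C (Fin K) (RatFunc ℝ) := M.measuredRows (M.T θ * M.R)

/-- `C T(q, θ) H(q, θ)`. -/
def CTH (θ : Fin n → ℝ) : Matrix M.C M.C (RatFunc ℝ) := M.measuredRows (M.T θ * M.H θ)

/-- The point `e^{iω}` of the unit circle. -/
def circ (ω : ℝ) : ℂ := Complex.exp (Complex.I * (ω : ℂ))

/-- The power spectrum `Φ(ω, θ)` of all internal signals,
`T(e^{iω}) H(e^{iω}) Λ H(e^{iω})^* T(e^{iω})^*`. -/
def spectrum (θ : Fin n → ℝ) (ω : ℝ) : Matrix (Fin L) (Fin L) ℂ :=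
  evalAt (M.T θ) (circ ω) * evalAt (M.H θ) (circ ω) * (M.Λ θ).map (algebraMap ℝ ℂ) *
    (evalAt (M.H θ) (circ ω)).conjTranspose * (evalAt (M.T θ) (circ ω)).conjTranspose

/-- The power spectrum `C Φ(ω, θ) Cᵀ` of the measured signals. -/
def measuredSpectrum (θ : Fin n → ℝ) (ω : ℝ) : Matrix M.C M.C ℂ :=
  (M.spectrum θ ω).submatrix Subtype.val Subtype.val

/-- The defining properties of a model set: at every `θ ∈ Θ` all transfer functions are
well defined, the network model is well-posed and stable, and `H̃` is monic and
minimum phase. -/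
structure IsModelSet : Prop where
  den_G : ∀ θ ∈ M.Θ, ∀ a b, (M.Gform a b).denAt θ ≠ 0
  den_H : ∀ θ ∈ M.Θ, ∀ a b, (M.Hform a b).denAt θ ≠ 0
  proper_G : ∀ θ ∈ M.Θ, ∀ a b, IsProper (M.G θ a b)
  stable_G : ∀ θ ∈ M.Θ, ∀ a b, IsStable (M.G θ a b)
  hollow_G : ∀ θ ∈ M.Θ, ∀ a, M.G θ a a = 0
  stable_T : ∀ θ ∈ M.Θ, ∀ a b, IsStable (M.T θ a b)
  wellPosed : ∀ θ ∈ M.Θ, ∀ S : Finset (Fin L),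
    ((1 - M.Ginf θ).submatrix (Subtype.val : S → Fin L) Subtype.val).det ≠ 0
  proper_H : ∀ θ ∈ M.Θ, ∀ a b, IsProper (M.Htilde θ a b)
  stable_H : ∀ θ ∈ M.Θ, ∀ a b, IsStable (M.Htilde θ a b)
  monic_H : ∀ θ ∈ M.Θ, (M.Htilde θ).map limInf = 1
  minPhase_H : ∀ θ ∈ M.Θ, IsMinPhase (M.Htilde θ)
  posSemidef : ∀ θ ∈ M.Θ, (M.Λ θ).PosSemidef

/-- The power spectrum of the measured signals has full rank at almost all frequencies. -/
def FullRankSpectrum : Prop :=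
  ∀ θ ∈ M.Θ, ∀ᵐ ω : ℝ, (M.measuredSpectrum θ ω).rank = M.C.card

/-- The rational form of an entry of `G` or of `H̃`. -/
def form : (Fin L × Fin L) ⊕ (M.C × M.C) → ParamTF n
  | Sum.inl e => M.Gform e.1 e.2
  | Sum.inr e => M.Hform e.1 e.2

/-- The entries of `G` and `H̃` are parameterized independently: no two of them share a
parameter. -/
def IndependentlyParameterized : Prop :=
  ∀ e e', e ≠ e' → Disjoint (M.form e).params (M.form e').params

/-- Either `G` is strictly proper, or `Λ` is diagonal and there are no algebraic loops. -/
def FeedthroughCondition : Prop :=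
  (∀ θ ∈ M.Θ, ∀ a b, IsStrictlyProper (M.G θ a b)) ∨
  ((∀ θ ∈ M.Θ, (M.Λ θ).IsDiag) ∧
    ∃ σ : Equiv.Perm (Fin L), ∀ θ ∈ M.Θ, ∀ a b, a < b → M.Ginf θ (σ a) (σ b) = 0)

/-- Every submatrix of `[(G - I)  X]` that does not depend on `θ` has rank equal to its
structural rank. -/
def FixedEntriesRegular : Prop :=
  ∀ (S : Finset (Fin L)) (U : Finset (Vertex L K M.C)),
    let sub : (Fin n → ℝ) → Matrix S U (RatFunc ℝ) := fun θ =>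
      (Matrix.fromCols (M.G θ - 1) (M.X θ)).submatrix Subtype.val Subtype.val
    (∀ θ ∈ M.Θ, ∀ θ' ∈ M.Θ, sub θ = sub θ') →
      ∀ θ ∈ M.Θ, (sub θ).rank = structuralRank (sub θ)

/-! ### The graph of a model set -/

/-- The entry of `[G  X]` that belongs to the pair of the vertex `v` and the signal `w_b`. -/
def entry (θ : Fin n → ℝ) (v : Vertex L K M.C) (b : Fin L) : RatFunc ℝ :=
  Matrix.fromCols (M.G θ) (M.X θ) b v

/-- There is an edge from `v` to `w_b` unless the corresponding entry is fixed to zero; no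
edge enters an external signal. -/
def Edge (v : Vertex L K M.C) : Vertex L K M.C → Prop
  | Sum.inl b => ¬ ∀ θ ∈ M.Θ, M.entry θ v b = 0
  | Sum.inr _ => False

/-- The entry from `v` to `w_b` is known (fixed), i.e. it does not depend on `θ`. -/
def Known (v : Vertex L K M.C) (b : Fin L) : Prop :=
  ∀ θ ∈ M.Θ, ∀ θ' ∈ M.Θ, M.entry θ v b = M.entry θ' v b

/-- The number of out-neighbors of a vertex. -/
def outDegree (v : Vertex L K M.C) : ℕ := {u | M.Edge v u}.ncard

/-- `N_j^-`: the internal in-neighbors of `w_j`, except the measured ones with a known edge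
to `w_j`. -/
def Nminus (j : Fin L) : Set (Fin L) :=
  {a | M.Edge (internal a) (internal j) ∧ ¬ (a ∈ M.C ∧ M.Known (internal a) j)}

/-- `N_i^*`: all internal in-neighbors of `w_i`. -/
def Nstar (i : Fin L) : Set (Fin L) := {a | M.Edge (internal a) (internal i)}

/-- The external signal `x` has out-degree one, and its out-going edge is known and ends in
`w_b`. -/
def CleanExcitation (x : Fin K ⊕ M.C) (b : Fin L) : Prop :=
  M.Edge (external x) (internal b) ∧ M.outDegree (external x) = 1 ∧ M.Known (external x) b

/-- `N_i^+`: the out-neighbors of `w_i`, except those to which `w_i` has a known edge and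
which are excited by an external signal of out-degree one with a known out-going edge. -/
def Nplus (i : Fin L) : Set (Fin L) :=
  {b | M.Edge (internal i) (internal b) ∧
    ¬ (M.Known (internal i) b ∧ ∃ x, M.CleanExcitation x b)}

/-- `D` is an `A - B` disconnecting set in the graph of the model set. -/
def Disconnects (D A B : Set (Fin L)) : Prop :=
  IsDisconnecting M.Edge (internal '' D) (internal '' A) (internal '' B)

/-- There is a path from `w_a` to `w_b` that is vertex disjoint with `D`. -/
def PathAvoiding (D : Set (Fin L)) (a b : Fin L) : Prop :=
  ∃ p, IsPath M.Edge (internal a) (internal b) p ∧ ∀ d ∈ D, internal d ∉ p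

/-- `w_a` is excited by one of the signals in `r`; different internal signals are then excited
by different ones. -/
def ExcitedByR (a : Fin L) : Prop := ∃ p, M.ρ p = a

/-! ### Generic identifiability -/

/-- The implication "equal `CTR` and equal spectrum imply equal `G_{ji}`" holds for almost all
`θ₀ ∈ Θ` and all `θ₁ ∈ Θ`. -/
def GenericallyIdentifiable (j i : Fin L) : Prop :=
  ∀ᵐ θ₀ : Fin n → ℝ, θ₀ ∈ M.Θ → ∀ θ₁ ∈ M.Θ,
    M.CTR θ₀ = M.CTR θ₁ →
    (∀ ω : ℝ, M.measuredSpectrum θ₀ ω = M.measuredSpectrum θ₁ ω) →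
    M.G θ₀ j i = M.G θ₁ j i

/-! ### The four synthesis schemes for `G_{ji}` -/

/-- Case 1: `w_i` and `w_j` measured. -/
structure Case1 (j i : Fin L) (D : Set (Fin L)) : Prop where
  not_mem : i ∉ D
  disconnects : M.Disconnects D {i} (M.Nminus j \ {i})
  excite : ∀ a ∈ D ∪ {i}, M.ExcitedByR a
  measure : ∀ a ∈ D ∪ {i, j}, a ∈ M.C

/-- A suitable indirect measurement `w_k` of `w_j` relative to a set `A`. -/
def IndirectlyMeasured (j : Fin L) (D A : Set (Fin L)) : Prop :=
  ∃ k ∈ M.C, k ≠ j ∧ M.Disconnects D A {k} ∧ M.PathAvoiding D j k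

/-- Case 2: `w_i` and `w_j` excited. -/
structure Case2 (j i : Fin L) (D : Set (Fin L)) : Prop where
  not_mem : j ∉ D
  disconnects : M.Disconnects D (M.Nplus i \ {j}) {j}
  excite : ∀ a ∈ D ∪ {i, j}, M.ExcitedByR a
  measure : ∀ a ∈ D, a ∈ M.C
  output : j ∈ M.C ∨ M.IndirectlyMeasured j D (M.Nplus i \ {j})

/-- Case 3: `w_i` unmeasured and `w_j` measured. -/
structure Case3 (j i : Fin L) (D : Set (Fin L)) : Prop where
  unmeasured : i ∉ M.C
  not_mem : i ∉ D
  disconnects : M.Disconnects D {i} (M.Nstar i ∪ (M.Nminus j \ {i}))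
  excite : ∀ a ∈ D ∪ {i}, M.ExcitedByR a
  measure : ∀ a ∈ D ∪ {j}, a ∈ M.C

/-- Case 4: `w_i` measured (as a member of `D`) and `w_j` unmeasured. -/
structure Case4 (j i : Fin L) (D : Set (Fin L)) : Prop where
  unmeasured : j ∉ M.C
  not_mem : j ∉ D
  disconnects : M.Disconnects D ((M.Nplus i \ {j}) ∪ {i}) {i, j}
  excite : ∀ a ∈ D ∪ {j}, M.ExcitedByR a
  measure : ∀ a ∈ D, a ∈ M.C
  output : M.IndirectlyMeasured j D ((M.Nplus i \ {j}) ∪ {i})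

/-- Some out-neighbor of `w_i` is left out of `N_i^+` although no `r` signal excites it, so
that it is left out because of a noise signal only. -/
def ReliesOnNoise (i : Fin L) : Prop :=
  ∃ b, M.Edge (internal i) (internal b) ∧ b ∉ M.Nplus i ∧ ¬ M.ExcitedByR b

/-- `C T H` is minimum phase for all models, as the spectral factor of `C Φ Cᵀ`. -/
def MinPhaseFactor : Prop := ∀ θ ∈ M.Θ, IsMinPhase (M.CTH θ)

end ModelData

end DynNet

end

/-! The row `j` of (1 - G) T = 1 and the column `i` of T (1 - G) = 1 are linear equations for `G j
i` whose coefficients are entries of T. The data `C T R` determine T in the measured rows and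
excited columns. The other entries are eliminated by the disconnecting set: if D separates A from B,
then on the rows D ∪ B every column of T in A is a combination of the columns in D, and dually for
rows (`exists_column_combination`, `exists_row_combination`). What remains is a square system in `G
j i` and the combination coefficients. Two models with equal data share its matrix and its
right-hand side, so `G j i` agrees as soon as the matrix is nonsingular.

The matrix is a submatrix of T, and by the complementary minor principle
(`eq_zero_of_complementary_minor`) it is nonsingular if the complementary minor of 1 - G is nonzero.
In Cases 1 and 3 this minor is principal, hence nonzero for every parameter by well-posedness. In
Case 2 with an indirect measurement `w_k` it has rows outside D ∪ {j} and columns outside D ∪ {k}; a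
path from `w_j` to `w_k` that avoids D is a perfect matching of this submatrix. A matrix with
independently parameterized entries and a perfect matching is generically nonsingular, provided that
its parameter-free submatrices cause no cancellation (`ae_det_ne_zero_of_matching`); this is what
the assumption on fixed entries supplies. Case 4 is an instance of Case 2.

Noise contributes when an out-neighbor of `w_i` is excited only by a noise signal. Two minimum phase
factors of one spectrum differ by a constant matrix, because a transfer matrix that is unitary on
the circle and has, like its inverse, no poles outside the closed disc is constant. The feedthrough
condition then forces that constant matrix to be the identity (`CTH_eq`), so the spectrum yields
further columns of T. -/

noncomputable section

namespace DynNet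

/-! ### Linear algebra -/

section LinearAlgebra

variable {F : Type*} [Field F]

/-- A vector is zero if it vanishes at the indices `π a` with `a ∉ S` and is annihilated by the
rows in `S`, and the submatrix with rows `S` and columns `π S` is nonsingular. -/
theorem eq_zero_of_minor {ι : Type} [Fintype ι] [DecidableEq ι] (B : Matrix ι ι F)
    (π : Equiv.Perm ι) (S : Finset ι)
    (hdet : (B.submatrix (Subtype.val : S → ι) (fun a => π a.1)).det ≠ 0) (v : ι → F)
    (h0 : ∀ a ∉ S, v (π a) = 0) (h : ∀ u ∈ S, ∑ w, B u w * v w = 0) : v = 0 := by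
  have key : (fun a : S => v (π a.1)) = 0 := by
    by_contra hne
    apply hdet
    apply Matrix.exists_mulVec_eq_zero_iff.1
    refine ⟨_, hne, ?_⟩
    funext u
    have hu := h u.1 u.2
    rw [← Equiv.sum_comp π, ← Finset.sum_subset (Finset.subset_univ S)
      (fun a _ ha => by rw [h0 a ha, mul_zero]), ← Finset.sum_coe_sort S] at hu
    exact hu
  funext b
  obtain ⟨a, rfl⟩ := π.surjective b
  by_cases ha : a ∈ S
  · exact congrFun key ⟨a, ha⟩
  · exact h0 a ha

/-- All principal minors are nonzero. -/
def PrincipalMinorsNeZero {ι : Type} [DecidableEq ι] (N : Matrix ι ι F) : Prop :=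
  ∀ S : Finset ι, (N.submatrix (Subtype.val : S → ι) Subtype.val).det ≠ 0

theorem PrincipalMinorsNeZero.transpose {ι : Type} [DecidableEq ι] {N : Matrix ι ι F}
    (h : PrincipalMinorsNeZero N) : PrincipalMinorsNeZero N.transpose := by
  intro S
  rw [← Matrix.transpose_submatrix, Matrix.det_transpose]
  exact h S

/-- A combination of vectors each of which is a combination supported on `D`. -/
theorem exists_sum_combination {ι : Type} [Fintype ι] {D Q : Set ι} (t : ι → ι → F) (A : Finset ι) (g : ι → F)
    (h : ∀ a ∈ A, ∃ s : ι → F, (∀ b ∉ D, s b = 0) ∧ ∀ q ∈ Q, ∑ b, t b q * s b = t a q) :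
    ∃ u : ι → F, (∀ b ∉ D, u b = 0) ∧ ∀ q ∈ Q, ∑ b, t b q * u b = ∑ a ∈ A, t a q * g a := by
  choose! s hs hs' using h
  refine ⟨fun b => ∑ a ∈ A, s a b * g a, fun b hb => Finset.sum_eq_zero fun a ha => by
    rw [hs a ha b hb, zero_mul], fun q hq => ?_⟩
  simp_rw [Finset.mul_sum]
  rw [Finset.sum_comm]
  refine Finset.sum_congr rfl fun a ha => ?_
  rw [← hs' a ha q hq, Finset.sum_mul]
  exact Finset.sum_congr rfl fun b _ => by ring

end LinearAlgebra

/-! ### Paths -/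

section Paths

variable {V : Type} {E : V → V → Prop}

theorem IsPath.single (a : V) : IsPath E a a [a] := by
  simp [IsPath]

theorem IsPath.reverse {a b : V} {p : List V} (h : IsPath E a b p) :
    IsPath (flip E) b a p.reverse := by
  obtain ⟨h1, h2, h3, h4⟩ := h
  refine ⟨by simpa using h2, by simpa using h1, ?_, by simpa using h4⟩
  rw [List.isChain_reverse]
  exact h3

theorem IsDisconnecting.flip {D A B : Set V} (h : IsDisconnecting E D A B) :
    IsDisconnecting (flip E) D B A := by
  intro b hb a ha p hp
  obtain ⟨d, hd, hdp⟩ := h a ha b hb _ (by simpa [_root_.flip] using hp.reverse)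
  exact ⟨d, hd, by simpa using hdp⟩

/-- The vertices that can be reached from `a` by a path avoiding `D`. -/
def reach (E : V → V → Prop) (D : Set V) (a : V) : Set V :=
  {b | ∃ p, IsPath E a b p ∧ ∀ d ∈ D, d ∉ p}

theorem mem_reach_self {D : Set V} {a : V} (h : a ∉ D) : a ∈ reach E D a :=
  ⟨[a], IsPath.single a, fun d hd hda => h (by simp_all)⟩

theorem notMem_of_mem_reach {D : Set V} {a b : V} (h : b ∈ reach E D a) : b ∉ D := by
  obtain ⟨p, hp, hD⟩ := h
  exact fun hb => hD b hb (List.mem_of_getLast? hp.2.1)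

/-- Paths must not repeat vertices: if `c` already lies on the path to `b`, the path is cut off at
`c` instead of being extended. -/
theorem reach_closed {D : Set V} {a b c : V} (h : b ∈ reach E D a) (hbc : E b c) (hc : c ∉ D) :
    c ∈ reach E D a := by
  obtain ⟨p, ⟨h1, h2, h3, h4⟩, hD⟩ := h
  by_cases hcp : c ∈ p
  · obtain ⟨l₁, l₂, rfl⟩ := List.append_of_mem hcp
    have hpre : l₁ ++ [c] <+: l₁ ++ c :: l₂ := ⟨l₂, by simp⟩
    refine ⟨l₁ ++ [c], ⟨?_, by simp, h3.prefix hpre, hpre.sublist.nodup h4⟩,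
      fun d hd hdp => hD d hd (hpre.subset hdp)⟩
    rw [← h1]
    cases l₁ <;> simp
  · refine ⟨p ++ [c], ⟨?_, by simp, ?_, ?_⟩, ?_⟩
    · rw [List.head?_append, h1]; rfl
    · rw [List.isChain_append]
      refine ⟨h3, by simp, ?_⟩
      intro x hx y hy
      rw [h2] at hx
      simp at hx hy
      subst hx; subst hy; exact hbc
    · rw [List.nodup_append]
      refine ⟨h4, by simp, ?_⟩
      rintro x hx y hy rfl
      simp at hy
      exact hcp (hy ▸ hx)
    · intro d hd hdp
      rcases List.mem_append.1 hdp with h | h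
      · exact hD d hd h
      · simp at h; exact hc (h ▸ hd)

theorem notMem_reach_of_isDisconnecting {D A B : Set V} (h : IsDisconnecting E D A B) {a b : V}
    (ha : a ∈ A) (hb : b ∈ B) : b ∉ reach E D a := by
  rintro ⟨p, hp, hD⟩
  obtain ⟨d, hd, hdp⟩ := h a ha b hb p hp
  exact hD d hd hdp

/-- A path from `a` to `b` closes up to a cyclic permutation. -/
theorem IsPath.exists_perm [DecidableEq V] {a b : V} {p : List V} (h : IsPath E a b p) :
    ∃ π : Equiv.Perm V, π b = a ∧ (∀ v, v ≠ b → π v = v ∨ E v (π v)) ∧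
      (∀ v, v ∉ p → π v = v) ∧ ∀ v, π v ∈ p ↔ v ∈ p := by
  obtain ⟨h1, h2, h3, h4⟩ := h
  -- The cycle sends each vertex of the path to its successor and the last vertex back to the first.
  refine ⟨p.formPerm, ?_, ?_, fun v hv => List.formPerm_apply_of_notMem hv,
    fun v => List.formPerm_mem_iff_mem⟩
  · cases p with
    | nil => simp at h1
    | cons x xs =>
      have hb : (x :: xs).getLast (by simp) = b := by
        rw [List.getLast?_eq_some_getLast (by simp)] at h2
        simpa using h2
      rw [← hb, List.formPerm_apply_getLast]
      simpa using h1
  · intro v hvb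
    by_cases hv : v ∈ p
    · right
      obtain ⟨m, hm, rfl⟩ := List.getElem_of_mem hv
      have hm1 : m + 1 < p.length := by
        by_contra hlt
        have : m = p.length - 1 := by omega
        subst this
        rw [List.getLast?_eq_getElem?, List.getElem?_eq_getElem hm] at h2
        exact hvb (by simpa using h2)
      rw [List.formPerm_apply_lt_getElem _ h4 _ hm1]
      exact h3.getElem m hm1
    · exact Or.inl (List.formPerm_apply_of_notMem hv)

end Paths

/-! ### Disconnecting sets and the inverse of `1 - G` -/

section Disconnecting

variable {F : Type*} [Field F] {ι : Type} [Fintype ι] [DecidableEq ι]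

/-- If the columns of `N` in `S` vanish outside `S ∪ D`, then outside `S` a column of the inverse
`T` with index in `S` is a combination of the columns with index in `D`. -/
theorem exists_combination_of_closed {N T : Matrix ι ι F} (hTN : T * N = 1)
    (hN : PrincipalMinorsNeZero N) (S : Finset ι) (D : Set ι)
    (hS : ∀ r ∉ S, r ∉ D → ∀ c ∈ S, N r c = 0) {a : ι} (ha : a ∈ S) :
    ∃ s : ι → F, (∀ b ∉ D, s b = 0) ∧ ∀ q ∉ S, ∑ b, T q b * s b = T q a := by
  -- Solve the principal block on `S` for the unit vector at `a` and extend by zero to `v`. Then e_a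
  -- - N v vanishes on `S` by the choice of `y` and off S ∪ D by `hS`, while T (e_a - N v) = T e_a -
  -- v agrees with the column `a` of T outside `S`.
  obtain ⟨y, hy⟩ : ∃ y : S → F,
      (N.submatrix (Subtype.val : S → ι) Subtype.val).mulVec y = Pi.single ⟨a, ha⟩ 1 := by
    refine ⟨(N.submatrix (Subtype.val : S → ι) Subtype.val)⁻¹.mulVec (Pi.single ⟨a, ha⟩ 1), ?_⟩
    rw [Matrix.mulVec_mulVec, Matrix.mul_nonsing_inv _ (isUnit_iff_ne_zero.2 (hN S)),
      Matrix.one_mulVec]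
  set v : ι → F := fun c => if h : c ∈ S then y ⟨c, h⟩ else 0 with hv
  have hNv : ∀ r, N.mulVec v r = ∑ c : S, N r c.1 * y c := by
    intro r
    simp only [Matrix.mulVec, dotProduct]
    rw [← Finset.sum_subset (Finset.subset_univ S) (fun c _ hc => by simp [hv, hc]),
      ← Finset.sum_coe_sort S]
    exact Finset.sum_congr rfl fun c _ => by simp [hv]
  refine ⟨Pi.single a 1 - N.mulVec v, ?_, ?_⟩
  · intro b hb
    rw [Pi.sub_apply, hNv]
    by_cases hbS : b ∈ S
    · have := congrFun hy ⟨b, hbS⟩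
      simp only [Matrix.mulVec, dotProduct, Matrix.submatrix_apply] at this
      rw [this]
      by_cases hba : b = a
      · subst hba; simp
      · rw [Pi.single_eq_of_ne hba, Pi.single_eq_of_ne (by simpa using hba), sub_zero]
    · rw [Pi.single_eq_of_ne (fun h : b = a => hbS (h ▸ ha)), zero_sub, neg_eq_zero]
      exact Finset.sum_eq_zero fun c _ => by rw [hS b hbS hb c c.2, zero_mul]
  · intro q hq
    have h1 : T.mulVec (Pi.single a 1 - N.mulVec v) q = T q a - v q := by
      rw [Matrix.mulVec_sub, Matrix.mulVec_mulVec, hTN, Matrix.one_mulVec]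
      simp
    have h2 : v q = 0 := by simp [hv, hq]
    rw [h2, sub_zero] at h1
    exact h1

variable {E : ι → ι → Prop}

/-- If `D` disconnects `A` from `B` in the graph of `1 - N`, then in the rows `D ∪ B` the columns
`A` of the inverse `T` are combinations of the columns `D`. -/
theorem exists_column_combination {N T : Matrix ι ι F} (hTN : T * N = 1)
    (hN : PrincipalMinorsNeZero N) (hE : ∀ a b, a ≠ b → N b a ≠ 0 → E a b) {D A B : Set ι}
    (hD : IsDisconnecting E D A B) {a : ι} (ha : a ∈ A) :
    ∃ s : ι → F, (∀ b ∉ D, s b = 0) ∧ ∀ q ∈ D ∪ B, ∑ b, T q b * s b = T q a := by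
  classical
  by_cases haD : a ∈ D
  · refine ⟨Pi.single a 1, fun b hb => Pi.single_eq_of_ne (fun h : b = a => hb (h ▸ haD)) _, fun q _ => ?_⟩
    simp [Pi.single_apply]
  -- The closed set consists of the vertices reachable from `a` without meeting D: an edge can leave
  -- it only into D, and it misses D ∪ B.
  · obtain ⟨s, hs, hs'⟩ := exists_combination_of_closed hTN hN
      (Finset.univ.filter (· ∈ reach E D a)) D (fun r hr hrD c hc => by
        simp only [Finset.mem_filter, Finset.mem_univ, true_and] at hr hc
        by_contra hne
        exact hr (reach_closed hc (hE c r (fun h => hr (h ▸ hc)) hne) hrD))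
      (a := a) (by simpa using mem_reach_self haD)
    refine ⟨s, hs, fun q hq => hs' q ?_⟩
    simp only [Finset.mem_filter, Finset.mem_univ, true_and]
    rcases hq with hq | hq
    · exact fun h => notMem_of_mem_reach h hq
    · exact notMem_reach_of_isDisconnecting hD ha hq

/-- The dual of `exists_column_combination`. -/
theorem exists_row_combination {N T : Matrix ι ι F} (hNT : N * T = 1)
    (hN : PrincipalMinorsNeZero N) (hE : ∀ a b, a ≠ b → N b a ≠ 0 → E a b) {D A B : Set ι}
    (hD : IsDisconnecting E D B A) {a : ι} (ha : a ∈ A) :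
    ∃ s : ι → F, (∀ b ∉ D, s b = 0) ∧ ∀ q ∈ D ∪ B, ∑ b, T b q * s b = T a q :=
  exists_column_combination (N := N.transpose) (T := T.transpose) (E := flip E)
    (by rw [← Matrix.transpose_mul, hNT, Matrix.transpose_one]) hN.transpose
    (fun a b hab h => hE b a hab.symm h) hD.flip ha

/-- A vector supported on `Q` that `T` maps to a vector vanishing on `π Q` is zero, if the
complementary minor of the inverse `N` is nonzero. -/
theorem eq_zero_of_complementary_minor {N T : Matrix ι ι F} (hNT : N * T = 1)
    (π : Equiv.Perm ι) (Q : Set ι) (S : Finset ι) (hS : ∀ a, a ∈ S ↔ a ∉ Q)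
    (hdet : (N.submatrix (Subtype.val : S → ι) (fun a => π a.1)).det ≠ 0)
    (u : ι → F) (hu : ∀ b ∉ Q, u b = 0) (h : ∀ q ∈ Q, ∑ b, T (π q) b * u b = 0) : u = 0 := by
  -- The vector T u vanishes on π Q, and the rows of N in `S` annihilate it because N T u = u is
  -- supported on Q.
  have hv : T.mulVec u = 0 := by
    refine eq_zero_of_minor N π S hdet _ (fun a ha => ?_) fun r hr => ?_
    · exact h a (by rw [hS] at ha; exact not_not.1 ha)
    · have h1 : N.mulVec (T.mulVec u) r = u r := by
        rw [Matrix.mulVec_mulVec, hNT, Matrix.one_mulVec]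
      rw [hu r ((hS r).1 hr)] at h1
      exact h1
  have : N.mulVec (T.mulVec u) = u := by rw [Matrix.mulVec_mulVec, hNT, Matrix.one_mulVec]
  rw [← this, hv, Matrix.mulVec_zero]

/-- The dual statement for principal minors. -/
theorem eq_zero_of_principal_minor {N T : Matrix ι ι F} (hTN : T * N = 1)
    (hN : PrincipalMinorsNeZero N) (Q : Set ι)
    (u : ι → F) (hu : ∀ b ∉ Q, u b = 0) (h : ∀ q ∈ Q, ∑ b, T b q * u b = 0) : u = 0 := by
  classical
  exact eq_zero_of_complementary_minor (N := N.transpose) (T := T.transpose)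
    (by rw [← Matrix.transpose_mul, hTN, Matrix.transpose_one]) 1 Q (Finset.univ.filter (· ∉ Q))
    (by simp) (hN.transpose _) u hu h

end Disconnecting

/-! ### Identification of an entry of `G` from rows and from columns of `T` -/

section Identification

variable {F : Type*} [Field F] {ι : Type} [Fintype ι] [DecidableEq ι] {E : ι → ι → Prop}

theorem hasEdge_of_one_sub {ι : Type} [DecidableEq ι] {E : ι → ι → Prop} {G : Matrix ι ι F} (hE : ∀ a b, G b a ≠ 0 → E a b) (a b : ι)
    (hab : a ≠ b) (h : (1 - G) b a ≠ 0) : E a b := by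
  apply hE
  rwa [Matrix.sub_apply, Matrix.one_apply_ne hab.symm, zero_sub, neg_ne_zero] at h

open Classical in
/-- The row `j` of `T = (1 - G)⁻¹`, in which the rows in `A` have been replaced by combinations of
rows in a set `D` that disconnects `B` from `A`. -/
theorem exists_row_split {G T : Matrix ι ι F} (hT : (1 - G) * T = 1)
    (hN : PrincipalMinorsNeZero (1 - G)) (hE : ∀ a b, G b a ≠ 0 → E a b) {D A B : Set ι}
    (hD : IsDisconnecting E D B A) (i j : ι) :
    ∃ u : ι → F, (∀ b ∉ D, u b = 0) ∧ ∀ q ∈ D ∪ B,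
      G j i * T i q + ∑ b, T b q * u b =
        T j q - (1 : Matrix ι ι F) j q -
          ∑ a with a ≠ i ∧ a ∉ A, G j a * T a q := by
  obtain ⟨u, hu, hu'⟩ := exists_sum_combination (D := D) (Q := D ∪ B) (fun a q => T a q)
    (Finset.univ.filter fun a => a ≠ i ∧ a ∈ A) (G j) (by
      intro a ha
      obtain ⟨s, hs, hs'⟩ := exists_row_combination hT hN (hasEdge_of_one_sub hE) hD
        (a := a) (by simp at ha; exact ha.2)
      exact ⟨s, hs, fun q hq => by rw [← hs' q hq]⟩)
  refine ⟨u, hu, fun q hq => ?_⟩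
  have h1 : T j q - ∑ a, G j a * T a q = (1 : Matrix ι ι F) j q := by
    have := congrFun (congrFun hT j) q
    rwa [Matrix.sub_mul, Matrix.one_mul, Matrix.sub_apply, Matrix.mul_apply] at this
  have h2 : ∑ a, G j a * T a q = G j i * T i q + ((∑ a with a ≠ i ∧ a ∈ A, G j a * T a q) +
      ∑ a with a ≠ i ∧ a ∉ A, G j a * T a q) := by
    rw [← Finset.add_sum_erase _ _ (Finset.mem_univ i),
      ← Finset.sum_filter_add_sum_filter_not (Finset.univ.erase i) (· ∈ A)]
    congr 3 <;> · ext; simp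
  rw [hu' q hq, ← h1, h2, Finset.sum_congr rfl fun a _ => mul_comm (T a q) (G j a)]
  ring

open Classical in
/-- The dual of `exists_row_split`. -/
theorem exists_column_split {G T : Matrix ι ι F} (hT : T * (1 - G) = 1)
    (hN : PrincipalMinorsNeZero (1 - G)) (hE : ∀ a b, G b a ≠ 0 → E a b) {D A B : Set ι}
    (hD : IsDisconnecting E D A B) (i j : ι) :
    ∃ u : ι → F, (∀ b ∉ D, u b = 0) ∧ ∀ q ∈ D ∪ B,
      G j i * T q j + ∑ b, T q b * u b =
        T q i - (1 : Matrix ι ι F) q i -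
          ∑ a with a ≠ j ∧ a ∉ A, G a i * T q a := by
  have htr : (1 - G).transpose = 1 - G.transpose := by simp
  obtain ⟨u, hu, hu'⟩ := exists_row_split (G := G.transpose) (T := T.transpose) (E := flip E)
    (by rw [← htr, ← Matrix.transpose_mul, hT, Matrix.transpose_one])
    (by rw [← htr]; exact hN.transpose) (fun a b h => hE b a h) hD.flip j i
  refine ⟨u, hu, fun q hq => ?_⟩
  have := hu' q hq
  simp only [Matrix.transpose_apply] at this
  rw [this, Matrix.one_apply, Matrix.one_apply]
  simp [eq_comm]

variable {G T : Bool → Matrix ι ι F}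

/-- The two models give linear systems with the same matrix, T with rows and columns in D ∪ {i}, and
the same right-hand side. Its nonsingularity comes from a principal minor of 1 - G. -/
theorem entry_eq_of_rows (hT : ∀ k, (1 - G k) * T k = 1) (hT' : ∀ k, T k * (1 - G k) = 1)
    (hN : ∀ k, PrincipalMinorsNeZero (1 - G k)) (hE : ∀ k a b, G k b a ≠ 0 → E a b)
    {D A : Set ι} {i j : ι} (hi : i ∉ D) (hD : IsDisconnecting E D {i} A)
    (hTD : ∀ q ∈ D ∪ {i}, ∀ a ∈ D ∪ {i, j}, T true a q = T false a q)
    (hknown : ∀ q ∈ D ∪ {i}, ∀ a, a ≠ i → a ∉ A →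
      G true j a * T true a q = G false j a * T false a q) :
    G true j i = G false j i := by
  choose u hu hu' using fun k => exists_row_split (hT k) (hN k) (hE k) hD i j
  -- Since `i` is not in D, the coordinate `i` is free to carry the difference of the two entries of
  -- G.
  have key : (fun b => u true b - u false b + if b = i then G true j i - G false j i else 0) = 0 := by
    refine eq_zero_of_principal_minor (hT' true) (hN true) (D ∪ {i}) _ (fun b hb => ?_)
      fun q hq => ?_
    · have h1 : b ∉ D := fun h => hb (Or.inl h)
      have h2 : b ≠ i := fun h => hb (Or.inr h)
      simp [hu _ b h1, h2]
    · have e : G true j i * T true i q + ∑ b, T true b q * u true b =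
          G false j i * T false i q + ∑ b, T false b q * u false b := by
        rw [hu' true q hq, hu' false q hq, hTD q hq j (by simp)]
        congr 1
        refine Finset.sum_congr rfl fun a ha => ?_
        simp only [Finset.mem_filter, Finset.mem_univ, true_and] at ha
        exact hknown q hq a ha.1 ha.2
      have e2 : ∑ b, T false b q * u false b = ∑ b, T true b q * u false b := by
        refine Finset.sum_congr rfl fun b _ => ?_
        by_cases hb : b ∈ D
        · rw [hTD q hq b (Or.inl hb)]
        · rw [hu _ b hb, mul_zero, mul_zero]
      rw [e2, ← hTD q hq i (by simp)] at e
      simp only [mul_add, mul_sub, Finset.sum_add_distrib, Finset.sum_sub_distrib, mul_ite,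
        mul_zero, Finset.sum_ite_eq', Finset.mem_univ, if_true]
      linear_combination e
  have := congrFun key i
  simpa [hu _ i hi, sub_eq_zero] using this

/-- Row `i` of T is not available here. As D also separates `i` from its in-neighbors and G has zero
diagonal, this row is a unit row plus a combination of rows in D. After substitution, the columns in
D determine all coefficients of rows in D, and column `i` then isolates the entry of G. -/
theorem entry_eq_of_rows_of_predecessors (hT : ∀ k, (1 - G k) * T k = 1)
    (hT' : ∀ k, T k * (1 - G k) = 1)
    (hN : ∀ k, PrincipalMinorsNeZero (1 - G k)) (hE : ∀ k a b, G k b a ≠ 0 → E a b)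
    (hG : ∀ k a, G k a a = 0)
    {D A : Set ι} {i j : ι} (hi : i ∉ D) (hD : IsDisconnecting E D {i} ({a | E a i} ∪ A))
    (hTD : ∀ q ∈ D ∪ {i}, ∀ a ∈ D ∪ {j}, T true a q = T false a q)
    (hknown : ∀ q ∈ D ∪ {i}, ∀ a, a ≠ i → a ∉ A →
      G true j a * T true a q = G false j a * T false a q) :
    G true j i = G false j i := by
  have hD1 : IsDisconnecting E D {i} A := fun a ha b hb => hD a ha b (Or.inr hb)
  have hD2 : IsDisconnecting E D {i} {a | E a i} := fun a ha b hb => hD a ha b (Or.inl hb)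
  choose u hu hu' using fun k => exists_row_split (hT k) (hN k) (hE k) hD1 i j
  choose t ht ht' using fun k => exists_row_split (hT k) (hN k) (hE k) hD2 i i
  classical
  have ht'' : ∀ k, ∀ q ∈ D ∪ {i}, T k i q = (1 : Matrix ι ι F) i q + ∑ b, T k b q * t k b := by
    intro k q hq
    have := ht' k q hq
    rw [hG, Finset.sum_eq_zero (s := Finset.filter _ _)] at this
    · linear_combination -this
    · intro a ha
      simp only [Finset.mem_filter, Finset.mem_univ, true_and, Set.mem_ofPred_eq] at ha
      rw [not_not.1 (fun h => ha.2 (hE k a i h)), zero_mul]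
  have hs : ∀ k, ∀ w : ι → F, (∀ b ∉ D, w b = 0) → ∀ q ∈ D ∪ {i},
      ∑ b, T k b q * w b = ∑ b, T true b q * w b := by
    intro k w hw q hq
    refine Finset.sum_congr rfl fun b _ => ?_
    by_cases hb : b ∈ D
    · cases k
      · rw [hTD q hq b (Or.inl hb)]
      · rfl
    · rw [hw b hb, mul_zero, mul_zero]
  have e : ∀ q ∈ D ∪ {i}, (G true j i - G false j i) * (1 : Matrix ι ι F) i q +
      ∑ b, T true b q * (G true j i * t true b + u true b - (G false j i * t false b + u false b))
        = 0 := by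
    intro q hq
    have e : G true j i * T true i q + ∑ b, T true b q * u true b =
        G false j i * T false i q + ∑ b, T false b q * u false b := by
      rw [hu' true q hq, hu' false q hq, hTD q hq j (by simp)]
      congr 1
      refine Finset.sum_congr rfl fun a ha => ?_
      simp only [Finset.mem_filter, Finset.mem_univ, true_and] at ha
      exact hknown q hq a ha.1 ha.2
    rw [ht'' true q hq, ht'' false q hq, hs false _ (hu false) q hq,
      hs false _ (ht false) q hq] at e
    simp only [mul_sub, mul_add, Finset.sum_add_distrib, Finset.sum_sub_distrib,
      mul_left_comm (T true _ q) (G _ j i), ← Finset.mul_sum]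
    linear_combination e
  have key : (fun b => G true j i * t true b + u true b - (G false j i * t false b + u false b))
      = 0 := by
    refine eq_zero_of_principal_minor (hT' true) (hN true) D _ (fun b hb => ?_) fun q hq => ?_
    · simp [hu _ b hb, ht _ b hb]
    · have := e q (Or.inl hq)
      rwa [Matrix.one_apply_ne (fun h : i = q => hi (h ▸ hq)), mul_zero, zero_add] at this
  have := e i (Or.inr rfl)
  rw [Finset.sum_eq_zero (fun b _ => by rw [congrFun key b]; exact mul_zero _)] at this
  simpa [sub_eq_zero] using this

/-- The system now has rows D ∪ {l} and columns D ∪ {j}, which need not be a principal block. The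
permutation `π` fixes D and moves `j` to `l`, so it pairs rows with columns both here and in the
complementary minor, whose nonvanishing is assumed. -/
theorem entry_eq_of_columns (hT : ∀ k, (1 - G k) * T k = 1) (hT' : ∀ k, T k * (1 - G k) = 1)
    (hN : ∀ k, PrincipalMinorsNeZero (1 - G k)) (hE : ∀ k a b, G k b a ≠ 0 → E a b)
    {D A : Set ι} {i j l : ι} (hj : j ∉ D) (hD : IsDisconnecting E D A {l})
    (π : Equiv.Perm ι) (hπj : π j = l) (hπD : ∀ d ∈ D, π d = d)
    (S : Finset ι) (hS : ∀ a, a ∈ S ↔ a ∉ D ∪ {j})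
    (hdet : ((1 - G true).submatrix (Subtype.val : S → ι) (fun a => π a.1)).det ≠ 0)
    (hTD : ∀ q ∈ D ∪ {l}, ∀ a ∈ D ∪ {i, j}, T true q a = T false q a)
    (hknown : ∀ q ∈ D ∪ {l}, ∀ a, a ≠ j → a ∉ A →
      G true a i * T true q a = G false a i * T false q a) :
    G true j i = G false j i := by
  choose u hu hu' using fun k => exists_column_split (hT' k) (hN k) (hE k) hD i j
  have key : (fun b => u true b - u false b + if b = j then G true j i - G false j i else 0) = 0 := by
    refine eq_zero_of_complementary_minor (hT true) π (D ∪ {j}) S hS hdet _ (fun b hb => ?_)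
      fun p hp => ?_
    · have h1 : b ∉ D := fun h => hb (Or.inl h)
      have h2 : b ≠ j := fun h => hb (Or.inr h)
      simp [hu _ b h1, h2]
    · obtain ⟨q, hq, hqp⟩ : ∃ q ∈ D ∪ {l}, q = π p := by
        rcases hp with hp | hp
        · exact ⟨p, Or.inl hp, (hπD p hp).symm⟩
        · exact ⟨l, Or.inr rfl, by rw [Set.mem_singleton_iff.1 hp, hπj]⟩
      rw [← hqp]
      have e : G true j i * T true q j + ∑ b, T true q b * u true b =
          G false j i * T false q j + ∑ b, T false q b * u false b := by
        rw [hu' true q hq, hu' false q hq, hTD q hq i (by simp)]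
        congr 1
        refine Finset.sum_congr rfl fun a ha => ?_
        simp only [Finset.mem_filter, Finset.mem_univ, true_and] at ha
        exact hknown q hq a ha.1 ha.2
      have e2 : ∑ b, T false q b * u false b = ∑ b, T true q b * u false b := by
        refine Finset.sum_congr rfl fun b _ => ?_
        by_cases hb : b ∈ D
        · rw [hTD q hq b (Or.inl hb)]
        · rw [hu _ b hb, mul_zero, mul_zero]
      rw [e2, ← hTD q hq j (by simp)] at e
      simp only [mul_add, mul_sub, Finset.sum_add_distrib, Finset.sum_sub_distrib, mul_ite,
        mul_zero, Finset.sum_ite_eq', Finset.mem_univ, if_true]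
      linear_combination e
  have := congrFun key j
  simpa [hu _ j hj, sub_eq_zero] using this

end Identification

/-! ### Generic nonsingularity of matrices with independently parameterized entries -/

section Generic

/-- The zero set of a nonzero polynomial is a null set. -/
theorem ae_eval_mvPolynomial_ne_zero {n : ℕ} {p : MvPolynomial (Fin n) ℝ} (hp : p ≠ 0) :
    ∀ᵐ x : Fin n → ℝ, MvPolynomial.eval x p ≠ 0 := by
  induction n with
  | zero =>
    filter_upwards with x hx
    apply hp
    rw [MvPolynomial.eq_C_of_isEmpty p] at hx ⊢
    simpa using hx
  | succ n ih =>
    set q := MvPolynomial.finSuccEquiv ℝ n p with hq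
    have hq0 : q ≠ 0 := by simpa [hq] using hp
    -- Fixing all variables but the first at `s` leaves a nonzero univariate polynomial. Any value
    -- `y` that is not one of its finitely many roots leaves a nonzero polynomial in the other
    -- variables, to which induction and Fubini apply.
    obtain ⟨s, hs⟩ : ∃ s, q.map (MvPolynomial.eval s) ≠ 0 := by
      by_contra! h
      apply hq0
      ext1 d
      refine MvPolynomial.funext fun s => ?_
      have := congrArg (fun r => Polynomial.coeff r d) (h s)
      simpa using this
    have key : ∀ᵐ z : ℝ × (Fin n → ℝ),
        MvPolynomial.eval (Fin.cons z.1 z.2 : Fin (n + 1) → ℝ) p ≠ 0 := by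
      have hmeas : MeasurableSet {z : ℝ × (Fin n → ℝ) |
          MvPolynomial.eval (Fin.cons z.1 z.2 : Fin (n + 1) → ℝ) p ≠ 0} := by
        apply IsOpen.measurableSet
        apply isOpen_ne_fun _ continuous_const
        refine (MvPolynomial.continuous_eval p).comp ?_
        refine continuous_pi fun k => ?_
        refine Fin.cases ?_ (fun k => ?_) k
        · simpa using continuous_fst
        · simp only [Fin.cons_succ]
          fun_prop
      refine (Measure.ae_prod_mem_iff_ae_ae_mem hmeas).2 ?_
      have hfin : ∀ᵐ y : ℝ, (q.map (MvPolynomial.eval s)).eval y ≠ 0 := by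
        have : {y | (q.map (MvPolynomial.eval s)).eval y = 0}.Finite :=
          (Polynomial.finite_setOfPred_isRoot hs)
        simpa [ae_iff] using this.measure_zero volume
      filter_upwards [hfin] with y hy
      have h2 : ∀ t, MvPolynomial.eval (Fin.cons y t : Fin (n + 1) → ℝ) p =
          MvPolynomial.eval t (q.eval (MvPolynomial.C y)) := by
        intro t
        rw [MvPolynomial.eval_eq_eval_mv_eval', ← Polynomial.eval_map_apply]
        simp [hq]
      have := ih (p := q.eval (MvPolynomial.C y)) (by
        intro h0
        apply hy
        rw [← MvPolynomial.eval_eq_eval_mv_eval', h2, h0, map_zero])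
      filter_upwards [this] with t ht
      simpa [h2] using ht
    have := (volume_preserving_piFinSuccAbove (fun _ : Fin (n + 1) => ℝ) 0).quasiMeasurePreserving.ae
      key
    filter_upwards [this] with x hx
    simpa using hx

theorem ae_map_eval_ne_zero {n : ℕ} {P : (MvPolynomial (Fin n) ℝ)[X]} (hP : P ≠ 0) :
    ∀ᵐ θ : Fin n → ℝ, P.map (MvPolynomial.eval θ) ≠ 0 := by
  filter_upwards [ae_eval_mvPolynomial_ne_zero (leadingCoeff_ne_zero.2 hP)] with θ hθ h0
  apply hθ
  rw [leadingCoeff, ← coeff_map, h0, coeff_zero]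

theorem ParamTF.map_num_congr {n : ℕ} {f : ParamTF n} {θ θ' : Fin n → ℝ}
    (h : ∀ k ∈ f.params, θ k = θ' k) :
    f.num.map (MvPolynomial.eval θ) = f.num.map (MvPolynomial.eval θ') ∧
      f.denAt θ = f.denAt θ' := by
  constructor <;> ext d
  · simp only [coeff_map]
    exact MvPolynomial.eval₂Hom_congr' rfl (fun k hk _ => h k ⟨d, Or.inl hk⟩) rfl
  · simp only [ParamTF.denAt, coeff_map]
    exact MvPolynomial.eval₂Hom_congr' rfl (fun k hk _ => h k ⟨d, Or.inr hk⟩) rfl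

theorem ParamTF.denAt_congr {n : ℕ} {f : ParamTF n} {θ θ' : Fin n → ℝ}
    (h : ∀ k ∈ f.params, θ k = θ' k) : f.denAt θ = f.denAt θ' :=
  (ParamTF.map_num_congr h).2

theorem ParamTF.eval_congr {n : ℕ} {f : ParamTF n} {θ θ' : Fin n → ℝ}
    (h : ∀ k ∈ f.params, θ k = θ' k) : f.eval θ = f.eval θ' := by
  rw [ParamTF.eval, ParamTF.eval, (ParamTF.map_num_congr h).1, (ParamTF.map_num_congr h).2]

variable {n : ℕ}

/-- The determinant of a parameterized matrix either is generically nonzero or vanishes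
identically. -/
theorem ae_det_ne_zero_or {ι : Type} [Fintype ι] [DecidableEq ι] (A : ι → ι → ParamTF n) :
    (∀ᵐ θ : Fin n → ℝ, (∀ a b, (A a b).denAt θ ≠ 0) →
      (Matrix.of fun a b => (A a b).eval θ).det ≠ 0) ∨
    ∀ θ, (∀ a b, (A a b).denAt θ ≠ 0) → (Matrix.of fun a b => (A a b).eval θ).det = 0 := by
  -- Each entry is multiplied by the product of all denominators, so that the determinant becomes a
  -- polynomial that vanishes together with the original one.
  set N : Matrix ι ι (MvPolynomial (Fin n) ℝ)[X] := Matrix.of fun a b =>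
    (A a b).num * ∏ x ∈ Finset.univ.erase (a, b), (A x.1 x.2).den with hN
  have key : ∀ θ, (∀ a b, (A a b).denAt θ ≠ 0) →
      ((Matrix.of fun a b => (A a b).eval θ).det = 0 ↔
        N.det.map (MvPolynomial.eval θ) = 0) := by
    intro θ hθ
    set Δ : RatFunc ℝ := algebraMap ℝ[X] (RatFunc ℝ) (∏ x : ι × ι, (A x.1 x.2).denAt θ) with hΔ
    have hΔ0 : Δ ≠ 0 := by
      rw [hΔ, Ne, FaithfulSMul.algebraMap_eq_zero_iff, Finset.prod_eq_zero_iff]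
      rintro ⟨x, -, hx⟩
      exact hθ _ _ hx
    have hmat : N.map ((algebraMap ℝ[X] (RatFunc ℝ)).comp
        (mapRingHom (MvPolynomial.eval θ))) = Δ • Matrix.of fun a b => (A a b).eval θ := by
      ext a b
      have hd : algebraMap ℝ[X] (RatFunc ℝ) ((A a b).denAt θ) ≠ 0 := by
        rw [Ne, FaithfulSMul.algebraMap_eq_zero_iff]; exact hθ a b
      have e : Δ = algebraMap ℝ[X] (RatFunc ℝ) ((A a b).denAt θ) *
          algebraMap ℝ[X] (RatFunc ℝ) (∏ x ∈ Finset.univ.erase (a, b), (A x.1 x.2).denAt θ) := by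
        rw [hΔ, ← map_mul, ← Finset.mul_prod_erase _ _ (Finset.mem_univ (a, b))]
      simp only [Matrix.map_apply, Matrix.smul_apply, Matrix.of_apply, smul_eq_mul, hN,
        RingHom.comp_apply, map_mul, coe_mapRingHom, Polynomial.map_prod, ParamTF.eval]
      rw [e]
      field_simp
      simp [ParamTF.denAt]
    have hdet := congrArg Matrix.det hmat
    rw [Matrix.det_smul, ← RingHom.mapMatrix_apply, ← RingHom.map_det] at hdet
    rw [RingHom.comp_apply, coe_mapRingHom] at hdet
    rw [← FaithfulSMul.algebraMap_eq_zero_iff ℝ[X] (RatFunc ℝ), hdet]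
    simp [hΔ0]
  by_cases h0 : N.det = 0
  · right
    intro θ hθ
    rw [key θ hθ, h0, Polynomial.map_zero]
  · left
    filter_upwards [ae_map_eval_ne_zero h0] with θ hθ hden
    rwa [Ne, key θ hden]

/-- An independently parameterized matrix with a structurally perfect matching on its diagonal is
generically nonsingular, provided that its parameter-free submatrices are. -/
theorem ae_det_ne_zero_of_matching {ρ κ : Type} (A : ρ → κ → ParamTF n) (Θ : Set (Fin n → ℝ))
    (hden : ∀ θ ∈ Θ, ∀ a b, (A a b).denAt θ ≠ 0)
    (hindep : ∀ a b a' b', (a, b) ≠ (a', b') → Disjoint (A a b).params (A a' b').params)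
    (hfix : ∀ (ι : Type) [Fintype ι] [DecidableEq ι] (r : ι → ρ) (c : ι → κ),
      Function.Injective r → Function.Injective c →
      (∀ x y, ∀ θ ∈ Θ, ∀ θ' ∈ Θ, (A (r x) (c y)).eval θ = (A (r x) (c y)).eval θ') →
      (∀ x, ∀ θ ∈ Θ, (A (r x) (c x)).eval θ ≠ 0) →
      ∀ θ ∈ Θ, (Matrix.of fun x y => (A (r x) (c y)).eval θ).det ≠ 0)
    (m : ℕ) (ι : Type) [Fintype ι] [DecidableEq ι] (hm : Fintype.card ι = m)
    (r : ι → ρ) (c : ι → κ) (hr : Function.Injective r) (hc : Function.Injective c)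
    (hdiag : ∀ x, ¬ ∀ θ ∈ Θ, (A (r x) (c x)).eval θ = 0) :
    ∀ᵐ θ : Fin n → ℝ, θ ∈ Θ → (Matrix.of fun x y => (A (r x) (c y)).eval θ).det ≠ 0 := by
  classical
  induction m using Nat.strong_induction_on generalizing ι with
  | _ m ih =>
  by_cases hall : ∀ x y, ∀ θ ∈ Θ, ∀ θ' ∈ Θ, (A (r x) (c y)).eval θ = (A (r x) (c y)).eval θ'
  · refine Filter.Eventually.of_forall (hfix ι r c hr hc hall fun x θ hθ h0 => hdiag x ?_)
    intro θ' hθ'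
    rw [← h0, hall x x θ' hθ' θ hθ]
  push Not at hall
  obtain ⟨x, y, θ₁, hθ₁, θ₂, hθ₂, hne⟩ := hall
  -- Edges go from a row index to the column indices of its entries that are not identically zero;
  -- the entry at (`x`, `y`) genuinely depends on the parameters. A path from `y` to `x` closes up
  -- through this entry to a perfect matching, so deleting row `x` and column `y` leaves a smaller
  -- matrix with a perfect matching.
  set E : ι → ι → Prop := fun u v => ¬ ∀ θ ∈ Θ, (A (r u) (c v)).eval θ = 0 with hE
  by_cases hreach : x ∈ reach E ∅ y
  · obtain ⟨p, hp, -⟩ := hreach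
    obtain ⟨π, hπx, hπ, -, -⟩ := hp.exists_perm
    set S : Finset ι := Finset.univ.erase x with hS
    have hminor := ih (Fintype.card S) (by
        rw [← hm, Fintype.card_coe]
        exact Finset.card_lt_univ_of_notMem (x := x) (by simp [hS])) S rfl (fun a => r a.1)
      (fun a => c (π a.1)) (fun a b h => Subtype.ext (hr h))
      (fun a b h => Subtype.ext (π.injective (hc h))) (by
        intro a
        rcases hπ a.1 (Finset.ne_of_mem_erase a.2) with h | h
        · rw [h]; exact hdiag a
        · exact h)
    by_cases hex : ∃ θ ∈ Θ, (Matrix.of fun (a b : S) => (A (r a.1) (c (π b.1))).eval θ).det ≠ 0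
    · obtain ⟨θs, hθs, hdet⟩ := hex
      rcases ae_det_ne_zero_or (fun a b => A (r a) (c b)) with h | h
      · filter_upwards [h] with θ hθ hmem
        exact hθ fun a b => hden θ hmem _ _
      -- The determinant is affine in the entry at (`x`, `y`), with slope the determinant `hadj`,
      -- which is nonzero at `θs`. If it vanished identically, this entry would be constant on Θ.
      · exfalso
        set B : Matrix ι ι (RatFunc ℝ) := Matrix.of fun a b => (A (r a) (c b)).eval θs with hB
        have hadj : (B.updateRow x (Pi.single y 1)).det ≠ 0 := by
          intro h0
          obtain ⟨v, hv, hv0⟩ := Matrix.exists_mulVec_eq_zero_iff.2 h0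
          apply hv
          have hvy : v y = 0 := by
            have := congrFun hv0 x
            simpa [Matrix.mulVec, Matrix.updateRow_self] using this
          refine eq_zero_of_minor B π S hdet v (fun a ha => ?_) fun u hu => ?_
          · have : a = x := by simpa [hS] using ha
            rw [this, hπx, hvy]
          · have hux : u ≠ x := by simpa [hS] using hu
            have := congrFun hv0 u
            rw [Matrix.mulVec, Matrix.updateRow_ne hux] at this
            exact this
        have hconst : ∀ θ ∈ Θ, (A (r x) (c y)).eval θ = (A (r x) (c y)).eval θs := by
          intro θ hθ
          -- By independence the entry at (`x`, `y`) can be moved alone. The mixed point may lie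
          -- outside Θ, but no denominator vanishes there, which is all that the identity `h`
          -- requires.
          set θ' : Fin n → ℝ := fun k => if k ∈ (A (r x) (c y)).params then θ k else θs k with hθ'
          have h1 : ∀ k ∈ (A (r x) (c y)).params, θ' k = θ k := fun k hk => by simp [hθ', hk]
          have h2 : ∀ a b, (a, b) ≠ (x, y) → ∀ k ∈ (A (r a) (c b)).params, θ' k = θs k := by
            intro a b hab k hk
            have hd := hindep (r a) (c b) (r x) (c y) (fun h => hab (by
              rw [Prod.mk.injEq] at h ⊢
              exact ⟨hr h.1, hc h.2⟩))
            simp [hθ', Set.disjoint_left.1 hd hk]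
          have hden' : ∀ a b, (A (r a) (c b)).denAt θ' ≠ 0 := by
            intro a b
            by_cases hab : (a, b) = (x, y)
            · rw [Prod.mk.injEq] at hab
              rw [hab.1, hab.2, ParamTF.denAt_congr h1]
              exact hden θ hθ _ _
            · rw [ParamTF.denAt_congr (h2 a b hab)]
              exact hden θs hθs _ _
          have e1 : (Matrix.of fun a b => (A (r a) (c b)).eval θ') =
              B.updateRow x (B x + ((A (r x) (c y)).eval θ - (A (r x) (c y)).eval θs) •
                Pi.single y 1) := by
            ext1 a b
            by_cases hax : a = x
            · subst hax
              rw [Matrix.updateRow_self]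
              by_cases hby : b = y
              · subst hby
                simp [hB, ParamTF.eval_congr h1]
              · simp [hB, hby, ParamTF.eval_congr (h2 a b (by simpa using hby))]
            · rw [Matrix.updateRow_ne hax]
              simp [hB, ParamTF.eval_congr (h2 a b (by simp [hax]))]
          have e2 := h θ' hden'
          have e3 := h θs fun a b => hden θs hθs _ _
          rw [e1, Matrix.det_updateRow_add, Matrix.updateRow_eq_self, Matrix.det_updateRow_smul,
            e3, zero_add, mul_eq_zero] at e2
          exact sub_eq_zero.1 (e2.resolve_right hadj)
        exact hne (by rw [hconst θ₁ hθ₁, hconst θ₂ hθ₂])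
    · push Not at hex
      -- If the minor vanishes throughout Θ although it is generically nonzero on Θ, then Θ is a
      -- null set.
      filter_upwards [hminor] with θ hθ hmem
      exact absurd (hex θ hmem) (hθ hmem)
  -- If `x` cannot be reached from `y`, the matrix is block triangular with respect to the set
  -- reached from `y`. Both diagonal blocks are smaller, since `y` is in this set and `x` is not.
  · have hsub : ∀ P : ι → Prop, (∃ a, ¬ P a) → ∀ᵐ θ : Fin n → ℝ, θ ∈ Θ →
        (Matrix.of fun (a b : {a // P a}) => (A (r a.1) (c b.1)).eval θ).det ≠ 0 := by
      rintro P ⟨a, ha⟩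
      exact ih (Fintype.card {a // P a}) (by rw [← hm]; exact Fintype.card_subtype_lt ha) _ rfl
        (fun a => r a.1) (fun a => c a.1) (fun a b h => Subtype.ext (hr h))
        (fun a b h => Subtype.ext (hc h)) fun a => hdiag a
    filter_upwards [hsub (· ∈ reach E ∅ y) ⟨x, hreach⟩,
      hsub (· ∉ reach E ∅ y) ⟨y, not_not.2 (mem_reach_self (by simp))⟩] with θ h1 h2 hθ
    rw [Matrix.twoBlockTriangular_det' _ (· ∈ reach E ∅ y)]
    · refine mul_ne_zero (h1 hθ) ?_
      convert h2 hθ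
      rfl
    · intro a ha b hb
      by_contra hab
      exact hb (reach_closed ha (fun h => hab (h θ hθ)) (by simp))

end Generic

/-! ### The structural rank and the generic minors of `1 - G` -/

theorem det_ne_zero_of_rank_eq_card {F ι : Type*} [Field F] [Fintype ι] [DecidableEq ι]
    {A : Matrix ι ι F} (h : A.rank = Fintype.card ι) : A.det ≠ 0 := by
  intro h0
  obtain ⟨v, hv, hv0⟩ := Matrix.exists_mulVec_eq_zero_iff.2 h0
  apply hv
  have hsurj : Function.Surjective A.mulVecLin := by
    rw [← LinearMap.range_eq_top]
    apply Submodule.eq_top_of_finrank_eq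
    rw [Module.finrank_fintype_fun_eq_card, ← h]
    rfl
  exact (LinearMap.injective_iff_surjective.2 hsurj) (by simpa using hv0)

/-- A square matrix with nonzero diagonal has full structural rank. -/
theorem exists_det_ne_zero_of_pattern {ι : Type} [Fintype ι] [DecidableEq ι]
    (A : Matrix ι ι (RatFunc ℝ)) (hA : ∀ x, A x x ≠ 0) :
    ∃ B : Matrix ι ι (RatFunc ℝ), (∀ a b, B a b = 0 ↔ A a b = 0) ∧ B.det ≠ 0 := by
  classical
  -- The diagonal entry is the size of the matrix and each row has fewer off-diagonal ones than
  -- that: strict diagonal dominance.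
  set B : Matrix ι ι ℝ := Matrix.of fun a b =>
    if a = b then (Fintype.card ι : ℝ) else if A a b = 0 then 0 else 1 with hB
  have hdet : B.det ≠ 0 := by
    apply det_ne_zero_of_sum_row_lt_diag
    intro k
    have hk : B k k = Fintype.card ι := by simp [hB]
    rw [hk, Real.norm_natCast]
    calc ∑ j ∈ Finset.univ.erase k, ‖B k j‖ ≤ ∑ j ∈ Finset.univ.erase k, (1 : ℝ) := by
          refine Finset.sum_le_sum fun j hj => ?_
          have : k ≠ j := (Finset.ne_of_mem_erase hj).symm
          simp only [hB, Matrix.of_apply, if_neg this]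
          split_ifs <;> simp
      _ < Fintype.card ι := by
          rw [Finset.sum_const, nsmul_eq_mul, mul_one, Nat.cast_lt]
          exact Finset.card_lt_univ_of_notMem (x := k) (by simp)
  refine ⟨B.map RatFunc.C, fun a b => ?_, ?_⟩
  · simp only [Matrix.map_apply, map_eq_zero, hB, Matrix.of_apply]
    split_ifs with h1 h2
    · subst h1
      have : Nonempty ι := ⟨a⟩
      simp [hA]
    · simp [h2]
    · simp [h2]
  · rw [← RingHom.mapMatrix_apply, ← RingHom.map_det]
    simpa using hdet

/-- The bijections place nonzero entries on the diagonal, so some matrix of this pattern is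
nonsingular and the structural rank is full. -/
theorem det_ne_zero_of_rank_eq_structuralRank {ι σ κ : Type} [Fintype ι] [DecidableEq ι]
    [Fintype σ] [Fintype κ] (A : Matrix σ κ (RatFunc ℝ)) (e : ι ≃ σ) (f : ι ≃ κ)
    (hA : ∀ x, A (e x) (f x) ≠ 0) (h : A.rank = structuralRank A) :
    (A.submatrix e f).det ≠ 0 := by
  apply det_ne_zero_of_rank_eq_card
  rw [Matrix.rank_submatrix, h]
  have hle : A.rank ≤ Fintype.card ι := by
    rw [Fintype.card_congr e]; exact Matrix.rank_le_card_height A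
  refine le_antisymm (h ▸ hle) ?_
  obtain ⟨B, hB, hdet⟩ := exists_det_ne_zero_of_pattern (A.submatrix e f) hA
  refine le_csSup ⟨Fintype.card σ, ?_⟩ ⟨B.submatrix e.symm f.symm, fun a b => ?_, ?_⟩
  · rintro _ ⟨B, -, rfl⟩
    exact Matrix.rank_le_card_height B
  · simpa using hB (e.symm a) (f.symm b)
  · rw [Matrix.rank_submatrix, Matrix.rank_of_det_ne_zero hdet]

namespace ModelData

variable {L K n : ℕ} (M : ModelData L K n)

open Classical in
/-- A rational form of the entries of `G - 1`, without redundant parameters. -/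
def formSubOne (a b : Fin L) : ParamTF n :=
  if a = b then ⟨-1, 1⟩ else if ∀ θ ∈ M.Θ, M.G θ a b = 0 then ⟨0, 1⟩ else M.Gform a b

variable {M}

theorem params_formSubOne (a b : Fin L) :
    (M.formSubOne a b).params = ∅ ∨
      (M.formSubOne a b).params = (M.Gform a b).params := by
  rw [formSubOne]
  have h1 : ∀ d, ((1 : (MvPolynomial (Fin n) ℝ)[X]).coeff d).vars = ∅ := by
    intro d
    rw [coeff_one]
    split_ifs <;> simp
  split_ifs
  · left
    ext k
    simp [ParamTF.params, h1, MvPolynomial.vars_neg]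
  · left
    ext k
    simp [ParamTF.params, h1]
  · exact Or.inr rfl

theorem formSubOne_eval (hM : M.IsModelSet) {θ : Fin n → ℝ} (hθ : θ ∈ M.Θ) (a b : Fin L) :
    (M.formSubOne a b).eval θ = (M.G θ - 1) a b := by
  rw [formSubOne]
  split_ifs with h1 h2
  · subst h1
    simp [ParamTF.eval, ParamTF.denAt, hM.hollow_G θ hθ]
  · simp [ParamTF.eval, ParamTF.denAt, h2 θ hθ, h1]
  · simp [G, h1]

theorem formSubOne_denAt (hM : M.IsModelSet) {θ : Fin n → ℝ} (hθ : θ ∈ M.Θ) (a b : Fin L) :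
    (M.formSubOne a b).denAt θ ≠ 0 := by
  rw [formSubOne]
  split_ifs with h1 h2
  · simp [ParamTF.denAt]
  · simp [ParamTF.denAt]
  · exact hM.den_G θ hθ a b

theorem edge_internal_iff (a b : Fin L) :
    M.Edge (internal a) (internal b) ↔ ¬ ∀ θ ∈ M.Θ, M.G θ b a = 0 :=
  Iff.rfl

/-- A submatrix of `1 - G` with a structurally perfect matching is generically nonsingular. -/
theorem ae_det_submatrix_ne_zero (hM : M.IsModelSet) (hindep : M.IndependentlyParameterized)
    (hfixed : M.FixedEntriesRegular) (S : Finset (Fin L)) (π : Equiv.Perm (Fin L))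
    (hπ : ∀ a ∈ S, π a = a ∨ M.Edge (internal (π a)) (internal a)) :
    ∀ᵐ θ : Fin n → ℝ, θ ∈ M.Θ →
      ((1 - M.G θ).submatrix (Subtype.val : S → Fin L) (fun a => π a.1)).det ≠ 0 := by
  classical
  rcases M.Θ.eq_empty_or_nonempty with hΘ | ⟨θ₀, hθ₀⟩
  · simp [hΘ]
  have := ae_det_ne_zero_of_matching M.formSubOne M.Θ
    (fun θ hθ a b => formSubOne_denAt hM hθ a b) (by
      intro a b a' b' hne
      rcases params_formSubOne (M := M) a b with h | h <;> rw [h]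
      · simp
      rcases params_formSubOne (M := M) a' b' with h' | h' <;> rw [h']
      · simp
      exact hindep (Sum.inl (a, b)) (Sum.inl (a', b')) (by simpa using hne)) (by
      intro ι _ _ r c hr hc hknown hdiag θ hθ
      -- The assumption on fixed entries speaks of finite sets of rows and columns, so the
      -- injections `r` and `c` are replaced by their images; only internal columns occur.
      let S : Finset (Fin L) := Finset.univ.image r
      let U : Finset (Vertex L K M.C) := Finset.univ.image fun x => internal (c x)
      let e : ι ≃ S := Equiv.ofBijective (fun x => ⟨r x, by simp [S]⟩)
        ⟨fun x y h => hr (congrArg Subtype.val h), fun ⟨s, hs⟩ => by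
          obtain ⟨x, -, hx⟩ := Finset.mem_image.1 hs
          exact ⟨x, Subtype.ext hx⟩⟩
      let f : ι ≃ U := Equiv.ofBijective (fun x => ⟨internal (c x), by simp [U]⟩)
        ⟨fun x y h => hc (Sum.inl_injective (congrArg Subtype.val h)), fun ⟨s, hs⟩ => by
          obtain ⟨x, -, hx⟩ := Finset.mem_image.1 hs
          exact ⟨x, Subtype.ext hx⟩⟩
      have hsub : ∀ θ ∈ M.Θ, ∀ x y, ((Matrix.fromCols (M.G θ - 1) (M.X θ)).submatrix
          (Subtype.val : S → Fin L) (Subtype.val : U → Vertex L K M.C)) (e x) (f y) =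
          (M.formSubOne (r x) (c y)).eval θ := by
        intro θ hθ x y
        rw [formSubOne_eval hM hθ]
        rfl
      have hdet := det_ne_zero_of_rank_eq_structuralRank _ e f
        (fun x => (hsub θ hθ x x).trans_ne (hdiag x θ hθ))
        (hfixed S U (by
          intro θ hθ θ' hθ'
          ext1 a b
          obtain ⟨x, rfl⟩ := e.surjective a
          obtain ⟨y, rfl⟩ := f.surjective b
          exact (hsub θ hθ x y).trans ((hknown x y θ hθ θ' hθ').trans (hsub θ' hθ' x y).symm)) θ hθ)
      convert hdet using 2
      ext1 x y
      exact (hsub θ hθ x y).symm) _ S rfl (fun a => a.1) (fun a => π a.1) Subtype.val_injective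
    (fun a b h => Subtype.ext (π.injective h)) (by
      intro a h0
      by_cases hπa : π a.1 = a.1
      · have := h0 θ₀ hθ₀
        rw [formSubOne_eval hM hθ₀, hπa] at this
        simp [hM.hollow_G θ₀ hθ₀] at this
      · apply (edge_internal_iff _ _).1 ((hπ a.1 a.2).resolve_left hπa)
        intro θ hθ
        have := h0 θ hθ
        rw [formSubOne_eval hM hθ, Matrix.sub_apply, Matrix.one_apply_ne (Ne.symm hπa),
          sub_zero] at this
        exact this)
  filter_upwards [this] with θ hθ hmem
  have e : (1 - M.G θ).submatrix (Subtype.val : S → Fin L) (fun a => π a.1) =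
      -(Matrix.of fun (a b : S) => (M.formSubOne a.1 (π b.1)).eval θ) := by
    ext1 a b
    simp only [Matrix.submatrix_apply, Matrix.neg_apply, Matrix.of_apply]
    rw [formSubOne_eval hM hmem, Matrix.sub_apply, Matrix.sub_apply, neg_sub]
  rw [e, Matrix.det_neg]
  exact mul_ne_zero (pow_ne_zero _ (by norm_num)) (hθ hmem)

end ModelData

/-! ### Proper rational functions and their limits at infinity -/

section Proper

theorem isProper_iff {f : RatFunc ℝ} : IsProper f ↔ f.num.natDegree ≤ f.denom.natDegree := by
  rw [IsProper, RatFunc.intDegree]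
  omega

theorem num_mul_eq_of_eq_div {f : RatFunc ℝ} {p q : ℝ[X]} (hq : q ≠ 0)
    (h : f = algebraMap ℝ[X] (RatFunc ℝ) p / algebraMap ℝ[X] (RatFunc ℝ) q) :
    f.num * q = p * f.denom := by
  have hq' : algebraMap ℝ[X] (RatFunc ℝ) q ≠ 0 := by simpa using hq
  have hd : algebraMap ℝ[X] (RatFunc ℝ) f.denom ≠ 0 := by simpa using f.denom_ne_zero
  have h2 := RatFunc.num_div_denom f
  apply FaithfulSMul.algebraMap_injective ℝ[X] (RatFunc ℝ)
  rw [map_mul, map_mul]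
  rw [div_eq_iff hd] at h2
  rw [h2, h]
  field_simp

theorem isProper_of_eq_div {f : RatFunc ℝ} {p q : ℝ[X]} (hq : q ≠ 0)
    (h : f = algebraMap ℝ[X] (RatFunc ℝ) p / algebraMap ℝ[X] (RatFunc ℝ) q)
    (hpq : p.natDegree ≤ q.natDegree) : IsProper f := by
  rw [isProper_iff]
  have e := num_mul_eq_of_eq_div hq h
  by_cases hp : p = 0
  · subst hp
    simp [h]
  · have hf : f.num ≠ 0 := by
      intro h0
      rw [h0, zero_mul] at e
      exact mul_ne_zero hp f.denom_ne_zero e.symm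
    have e' := congrArg natDegree e
    rw [natDegree_mul hf hq, natDegree_mul hp f.denom_ne_zero] at e'
    omega

/-- Comparing top coefficients in the cross-multiplied identity computes the limit from any
fraction, reduced or not; sums and products come as unreduced fractions. -/
theorem limInf_mul_leadingCoeff {f : RatFunc ℝ} {p q : ℝ[X]} (hq : q ≠ 0)
    (h : f = algebraMap ℝ[X] (RatFunc ℝ) p / algebraMap ℝ[X] (RatFunc ℝ) q)
    (hpq : p.natDegree ≤ q.natDegree) : limInf f * q.leadingCoeff = p.coeff q.natDegree := by
  have e := congrArg (fun r => r.coeff (f.denom.natDegree + q.natDegree))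
    (num_mul_eq_of_eq_div hq h)
  rw [coeff_mul_add_eq_of_natDegree_le (isProper_iff.1 (isProper_of_eq_div hq h hpq)) le_rfl,
    add_comm, coeff_mul_add_eq_of_natDegree_le hpq le_rfl] at e
  have : f.denom.coeff f.denom.natDegree = 1 := RatFunc.monic_denom f
  rw [this, mul_one] at e
  exact e

theorem isProper_C (c : ℝ) : IsProper (RatFunc.C c) := by simp [IsProper]

theorem limInf_C (c : ℝ) : limInf (RatFunc.C c) = c := by simp [limInf]

theorem eq_div_add (f g : RatFunc ℝ) : f + g =
    algebraMap ℝ[X] (RatFunc ℝ) (f.num * g.denom + g.num * f.denom) /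
      algebraMap ℝ[X] (RatFunc ℝ) (f.denom * g.denom) := by
  have hf : algebraMap ℝ[X] (RatFunc ℝ) f.denom ≠ 0 := by simpa using f.denom_ne_zero
  have hg : algebraMap ℝ[X] (RatFunc ℝ) g.denom ≠ 0 := by simpa using g.denom_ne_zero
  conv_lhs => rw [← RatFunc.num_div_denom f, ← RatFunc.num_div_denom g]
  rw [map_add, map_mul, map_mul, map_mul]
  field_simp

theorem eq_div_mul (f g : RatFunc ℝ) : f * g =
    algebraMap ℝ[X] (RatFunc ℝ) (f.num * g.num) /
      algebraMap ℝ[X] (RatFunc ℝ) (f.denom * g.denom) := by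
  conv_lhs => rw [← RatFunc.num_div_denom f, ← RatFunc.num_div_denom g]
  rw [map_mul, map_mul, div_mul_div_comm]

theorem natDegree_add_num_le {f g : RatFunc ℝ} (hf : IsProper f) (hg : IsProper g) :
    (f.num * g.denom + g.num * f.denom).natDegree ≤ (f.denom * g.denom).natDegree := by
  rw [isProper_iff] at hf hg
  rw [natDegree_mul f.denom_ne_zero g.denom_ne_zero]
  refine (natDegree_add_le _ _).trans (max_le ?_ ?_)
  · exact natDegree_mul_le.trans (by omega)
  · exact natDegree_mul_le.trans (by omega)

theorem natDegree_mul_num_le {f g : RatFunc ℝ} (hf : IsProper f) (hg : IsProper g) :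
    (f.num * g.num).natDegree ≤ (f.denom * g.denom).natDegree := by
  rw [isProper_iff] at hf hg
  rw [natDegree_mul f.denom_ne_zero g.denom_ne_zero]
  exact natDegree_mul_le.trans (by omega)

/-- The ring of proper rational functions. -/
def properSubring : Subring (RatFunc ℝ) where
  carrier := {f | IsProper f}
  mul_mem' hf hg := isProper_of_eq_div (mul_ne_zero (RatFunc.denom_ne_zero _)
    (RatFunc.denom_ne_zero _)) (eq_div_mul _ _) (natDegree_mul_num_le hf hg)
  one_mem' := by simp [IsProper]
  add_mem' hf hg := isProper_of_eq_div (mul_ne_zero (RatFunc.denom_ne_zero _)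
    (RatFunc.denom_ne_zero _)) (eq_div_add _ _) (natDegree_add_num_le hf hg)
  zero_mem' := by simp [IsProper]
  neg_mem' {f} hf := by
    change IsProper (-f)
    rwa [IsProper, RatFunc.intDegree_neg]

/-- The limit at infinity as a ring homomorphism. -/
def limInfHom : properSubring →+* ℝ where
  toFun f := limInf f
  map_one' := by simpa using limInf_C 1
  map_zero' := by simpa using limInf_C 0
  map_mul' f g := by
    have hf : IsProper f := f.2
    have hg : IsProper g := g.2
    have e := limInf_mul_leadingCoeff (mul_ne_zero (RatFunc.denom_ne_zero _)
      (RatFunc.denom_ne_zero _)) (eq_div_mul f.1 g.1) (natDegree_mul_num_le hf hg)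
    rw [((RatFunc.monic_denom f.1).mul (RatFunc.monic_denom g.1)).leadingCoeff, mul_one,
      natDegree_mul (RatFunc.denom_ne_zero _) (RatFunc.denom_ne_zero _),
      coeff_mul_add_eq_of_natDegree_le (isProper_iff.1 hf) (isProper_iff.1 hg)] at e
    exact e
  map_add' f g := by
    have hf : IsProper f := f.2
    have hg : IsProper g := g.2
    have e := limInf_mul_leadingCoeff (mul_ne_zero (RatFunc.denom_ne_zero _)
      (RatFunc.denom_ne_zero _)) (eq_div_add f.1 g.1) (natDegree_add_num_le hf hg)
    rw [((RatFunc.monic_denom f.1).mul (RatFunc.monic_denom g.1)).leadingCoeff, mul_one,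
      natDegree_mul (RatFunc.denom_ne_zero _) (RatFunc.denom_ne_zero _), coeff_add,
      coeff_mul_add_eq_of_natDegree_le (isProper_iff.1 hf) le_rfl,
      add_comm f.1.denom.natDegree,
      coeff_mul_add_eq_of_natDegree_le (isProper_iff.1 hg) le_rfl] at e
    have h1 : f.1.denom.coeff f.1.denom.natDegree = 1 := RatFunc.monic_denom f.1
    have h2 : g.1.denom.coeff g.1.denom.natDegree = 1 := RatFunc.monic_denom g.1
    rw [h1, h2, mul_one, mul_one] at e
    exact e

theorem isProper_inv {f : RatFunc ℝ} (h : limInf f ≠ 0) : IsProper f⁻¹ := by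
  have h1 := le_natDegree_of_ne_zero h
  rw [IsProper, RatFunc.intDegree_inv, RatFunc.intDegree]
  omega

/-- Matrices over a subring. -/
theorem exists_map_subtype_eq {R : Type*} [CommRing R] (S : Subring R) {ι κ : Type}
    {A : Matrix ι κ R} (hA : ∀ a b, A a b ∈ S) : ∃ B : Matrix ι κ S, A = B.map Subtype.val :=
  ⟨Matrix.of fun a b => ⟨A a b, hA a b⟩, rfl⟩

theorem det_mem_subring {R : Type*} [CommRing R] (S : Subring R) {ι : Type} [Fintype ι]
    [DecidableEq ι] {A : Matrix ι ι R} (hA : ∀ a b, A a b ∈ S) : A.det ∈ S := by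
  obtain ⟨B, rfl⟩ := exists_map_subtype_eq S hA
  have := RingHom.map_det S.subtype B
  rw [RingHom.mapMatrix_apply] at this
  exact this ▸ B.det.2

theorem mul_mem_subring {R : Type*} [CommRing R] (S : Subring R) {ι κ τ : Type} [Fintype κ]
    {A : Matrix ι κ R} {B : Matrix κ τ R} (hA : ∀ a b, A a b ∈ S) (hB : ∀ a b, B a b ∈ S) (a b) :
    (A * B) a b ∈ S := by
  rw [Matrix.mul_apply]
  exact S.sum_mem fun c _ => S.mul_mem (hA _ _) (hB _ _)

/-- Cramer's rule: the adjugate stays in the subring, so only the inverse determinant has to be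
supplied. -/
theorem inv_mem_subring {R : Type*} [Field R] (S : Subring R) {ι : Type} [Fintype ι]
    [DecidableEq ι] {A : Matrix ι ι R} (hA : ∀ a b, A a b ∈ S) (h : A.det⁻¹ ∈ S) (a b) :
    A⁻¹ a b ∈ S := by
  rw [Matrix.inv_def, Ring.inverse_eq_inv', Matrix.smul_apply, smul_eq_mul]
  refine S.mul_mem h ?_
  rw [Matrix.adjugate_apply]
  refine det_mem_subring S fun c d => ?_
  by_cases hc : c = b
  · subst hc
    rw [Matrix.updateRow_self]
    by_cases hd : d = a
    · subst hd; simp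
    · simp [hd]
  · rw [Matrix.updateRow_ne hc]
    exact hA c d

theorem map_limInf_mul {ι κ τ : Type} [Fintype κ] {A : Matrix ι κ (RatFunc ℝ)}
    {B : Matrix κ τ (RatFunc ℝ)} (hA : ∀ a b, A a b ∈ properSubring)
    (hB : ∀ a b, B a b ∈ properSubring) : (A * B).map limInf = A.map limInf * B.map limInf := by
  obtain ⟨A, rfl⟩ := exists_map_subtype_eq _ hA
  obtain ⟨B, rfl⟩ := exists_map_subtype_eq _ hB
  have h1 : A.map Subtype.val * B.map Subtype.val = (A * B).map properSubring.subtype :=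
    (Matrix.map_mul (f := properSubring.subtype)).symm
  rw [h1]
  exact Matrix.map_mul (f := limInfHom)

theorem limInf_det {ι : Type} [Fintype ι] [DecidableEq ι] {A : Matrix ι ι (RatFunc ℝ)}
    (hA : ∀ a b, A a b ∈ properSubring) : limInf A.det = (A.map limInf).det := by
  obtain ⟨A, rfl⟩ := exists_map_subtype_eq _ hA
  have h1 := RingHom.map_det properSubring.subtype A
  rw [RingHom.mapMatrix_apply] at h1
  have h2 := RingHom.map_det limInfHom A
  rw [RingHom.mapMatrix_apply] at h2
  exact (congrArg limInf h1.symm).trans h2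

theorem det_ne_zero_of_limInf {ι : Type} [Fintype ι] [DecidableEq ι] {A : Matrix ι ι (RatFunc ℝ)}
    (hA : ∀ a b, A a b ∈ properSubring) (h : (A.map limInf).det ≠ 0) : A.det ≠ 0 := by
  intro h0
  rw [← limInf_det hA, h0] at h
  exact h (map_zero limInfHom)

theorem inv_mem_properSubring {ι : Type} [Fintype ι] [DecidableEq ι] {A : Matrix ι ι (RatFunc ℝ)}
    (hA : ∀ a b, A a b ∈ properSubring) (h : (A.map limInf).det ≠ 0) (a b) :
    A⁻¹ a b ∈ properSubring :=
  inv_mem_subring properSubring hA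
    (isProper_inv (by rwa [limInf_det hA])) a b

theorem map_limInf_one {ι : Type} [DecidableEq ι] :
    (1 : Matrix ι ι (RatFunc ℝ)).map limInf = 1 :=
  Matrix.map_one limInf (map_zero limInfHom) (map_one limInfHom)

end Proper

/-! ### Well-posedness: `1 - G` and `T` as proper rational matrices -/

namespace ModelData

variable {L K n : ℕ} {M : ModelData L K n}

theorem one_sub_G_mem (hM : M.IsModelSet) {θ : Fin n → ℝ} (hθ : θ ∈ M.Θ) (a b) :
    (1 - M.G θ) a b ∈ properSubring := by
  rw [Matrix.sub_apply, Matrix.one_apply]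
  refine Subring.sub_mem _ ?_ (hM.proper_G θ hθ a b)
  split_ifs
  · exact Subring.one_mem _
  · exact Subring.zero_mem _

theorem map_limInf_one_sub_G (hM : M.IsModelSet) {θ : Fin n → ℝ} (hθ : θ ∈ M.Θ) :
    (1 - M.G θ).map limInf = 1 - M.Ginf θ := by
  ext a b
  have h1 : (1 : Matrix (Fin L) (Fin L) (RatFunc ℝ)) a b ∈ properSubring := by
    rw [Matrix.one_apply]
    split_ifs
    · exact Subring.one_mem _
    · exact Subring.zero_mem _
  have := map_sub limInfHom ⟨_, h1⟩ ⟨_, hM.proper_G θ hθ a b⟩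
  refine this.trans ?_
  rw [Matrix.sub_apply, ← map_limInf_one]
  rfl

/-- Well-posedness concerns the values at infinity. The limit of a minor is the minor of the limit,
so the rational minors are nonzero too. -/
theorem principalMinorsNeZero (hM : M.IsModelSet) {θ : Fin n → ℝ} (hθ : θ ∈ M.Θ) :
    PrincipalMinorsNeZero (1 - M.G θ) := by
  intro S
  refine det_ne_zero_of_limInf (fun a b => one_sub_G_mem hM hθ _ _) ?_
  have := hM.wellPosed θ hθ S
  rwa [← map_limInf_one_sub_G hM hθ] at this

theorem det_one_sub_Ginf_ne_zero (hM : M.IsModelSet) {θ : Fin n → ℝ} (hθ : θ ∈ M.Θ) :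
    (1 - M.Ginf θ).det ≠ 0 := by
  have h := hM.wellPosed θ hθ Finset.univ
  let e : Fin L ≃ (Finset.univ : Finset (Fin L)) := (Equiv.subtypeUnivEquiv (by simp)).symm
  rwa [← Matrix.det_submatrix_equiv_self e, Matrix.submatrix_submatrix] at h

theorem det_one_sub_G_ne_zero (hM : M.IsModelSet) {θ : Fin n → ℝ} (hθ : θ ∈ M.Θ) :
    (1 - M.G θ).det ≠ 0 :=
  det_ne_zero_of_limInf (one_sub_G_mem hM hθ)
    (by rw [map_limInf_one_sub_G hM hθ]; exact det_one_sub_Ginf_ne_zero hM hθ)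

theorem one_sub_G_mul_T (hM : M.IsModelSet) {θ : Fin n → ℝ} (hθ : θ ∈ M.Θ) :
    (1 - M.G θ) * M.T θ = 1 :=
  Matrix.mul_nonsing_inv _ (isUnit_iff_ne_zero.2 (det_one_sub_G_ne_zero hM hθ))

theorem T_mul_one_sub_G (hM : M.IsModelSet) {θ : Fin n → ℝ} (hθ : θ ∈ M.Θ) :
    M.T θ * (1 - M.G θ) = 1 :=
  Matrix.nonsing_inv_mul _ (isUnit_iff_ne_zero.2 (det_one_sub_G_ne_zero hM hθ))

theorem T_mem (hM : M.IsModelSet) {θ : Fin n → ℝ} (hθ : θ ∈ M.Θ) (a b) :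
    M.T θ a b ∈ properSubring :=
  inv_mem_properSubring (one_sub_G_mem hM hθ)
    (by rw [map_limInf_one_sub_G hM hθ]; exact det_one_sub_Ginf_ne_zero hM hθ) a b

end ModelData

/-! ### Evaluation of rational functions -/

section Evaluation

/-- The ring of rational functions without a pole at `z`. -/
def regularSubring (z : ℂ) : Subring (RatFunc ℝ) where
  carrier := {f | aeval z f.denom ≠ 0}
  mul_mem' {f g} hf hg h := by
    have := aeval_eq_zero_of_dvd_aeval_eq_zero (RatFunc.denom_mul_dvd f g) h
    rw [map_mul] at this
    exact mul_ne_zero hf hg this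
  one_mem' := by simp
  add_mem' {f g} hf hg h := by
    have := aeval_eq_zero_of_dvd_aeval_eq_zero (RatFunc.denom_add_dvd f g) h
    rw [map_mul] at this
    exact mul_ne_zero hf hg this
  zero_mem' := by simp
  neg_mem' {f} hf := by
    intro h
    have e : -f = RatFunc.C (-1) * f := by simp
    rw [e] at h
    have := aeval_eq_zero_of_dvd_aeval_eq_zero (RatFunc.denom_mul_dvd _ f) h
    rw [RatFunc.denom_C, one_mul] at this
    exact hf this

theorem C_mem_regularSubring (z : ℂ) (c : ℝ) : RatFunc.C c ∈ regularSubring z := by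
  change aeval z (RatFunc.C c).denom ≠ 0
  simp

/-- The evaluation at `z` as a ring homomorphism. -/
def evalHom (z : ℂ) : regularSubring z →+* ℂ where
  toFun f := RatFunc.eval (algebraMap ℝ ℂ) z f
  map_one' := RatFunc.eval_one _ _
  map_zero' := RatFunc.eval_zero _ _
  map_mul' f g := RatFunc.eval_mul _ _ f.2 g.2
  map_add' f g := RatFunc.eval_add _ _ f.2 g.2

/-- Regularity is needed because evaluation at a pole returns the value of a division by zero and is
not multiplicative there. -/
theorem evalAt_mul {ι κ τ : Type} [Fintype κ] {A : Matrix ι κ (RatFunc ℝ)}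
    {B : Matrix κ τ (RatFunc ℝ)} {z : ℂ} (hA : ∀ a b, A a b ∈ regularSubring z)
    (hB : ∀ a b, B a b ∈ regularSubring z) : evalAt (A * B) z = evalAt A z * evalAt B z := by
  obtain ⟨A, rfl⟩ := exists_map_subtype_eq _ hA
  obtain ⟨B, rfl⟩ := exists_map_subtype_eq _ hB
  have h1 : A.map Subtype.val * B.map Subtype.val = (A * B).map (regularSubring z).subtype :=
    (Matrix.map_mul (f := (regularSubring z).subtype)).symm
  rw [h1]
  exact Matrix.map_mul (f := evalHom z)

theorem evalAt_one {ι : Type} [DecidableEq ι] (z : ℂ) :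
    evalAt (1 : Matrix ι ι (RatFunc ℝ)) z = 1 :=
  Matrix.map_one _ (RatFunc.eval_zero _ _) (RatFunc.eval_one _ _)

theorem evalAt_map_C {ι κ : Type} (A : Matrix ι κ ℝ) (z : ℂ) :
    evalAt (A.map RatFunc.C) z = A.map (algebraMap ℝ ℂ) := by
  ext a b
  simp [evalAt, RatFunc.eval_C]

/-- The ring of proper rational functions without poles outside the closed unit disc. -/
def outerSubring : Subring (RatFunc ℝ) :=
  properSubring ⊓ ⨅ z : {z : ℂ // 1 < ‖z‖}, regularSubring z

theorem mem_outerSubring {f : RatFunc ℝ} :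
    f ∈ outerSubring ↔ IsProper f ∧ ∀ z : ℂ, aeval z f.denom = 0 → ‖z‖ ≤ 1 := by
  rw [outerSubring, Subring.mem_inf, Subring.mem_iInf]
  refine and_congr Iff.rfl ⟨fun h z hz => ?_, fun h z hz => ?_⟩
  · by_contra hlt
    exact h ⟨z, not_le.1 hlt⟩ hz
  · exact absurd (h z hz) (not_le.2 z.2)

theorem C_mem_outerSubring (c : ℝ) : RatFunc.C c ∈ outerSubring :=
  mem_outerSubring.2 ⟨isProper_C c, fun z hz => absurd hz (C_mem_regularSubring z c)⟩

end Evaluation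

/-! ### Rational functions on the unit circle -/

section Circle

open ModelData

theorem norm_circ (ω : ℝ) : ‖circ ω‖ = 1 := by
  rw [circ, mul_comm, Complex.norm_exp_ofReal_mul_I]

theorem circ_ne_zero (ω : ℝ) : circ ω ≠ 0 := Complex.exp_ne_zero _

theorem conj_circ (ω : ℝ) : (starRingEnd ℂ) (circ ω) = (circ ω)⁻¹ := by
  rw [circ, ← Complex.exp_conj, ← Complex.exp_neg]
  simp

theorem continuous_circ : Continuous circ := by
  unfold circ
  fun_prop

/-- There are finitely many roots, and each is met at countably many frequencies, which differ by
multiples of 2π. -/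
theorem ae_aeval_circ_ne_zero {P : ℝ[X]} (hP : P ≠ 0) : ∀ᵐ ω : ℝ, aeval (circ ω) P ≠ 0 := by
  have hfib : ∀ z : ℂ, {ω : ℝ | circ ω = z}.Countable := by
    intro z
    rcases Set.eq_empty_or_nonempty {ω : ℝ | circ ω = z} with h | ⟨ω₀, hω₀⟩
    · rw [h]; exact Set.countable_empty
    · refine (Set.countable_range fun k : ℤ => ω₀ + k * (2 * Real.pi)).mono ?_
      intro ω hω
      have h : circ ω = circ ω₀ := Eq.trans hω (Eq.symm hω₀)
      obtain ⟨k, hk⟩ := Complex.exp_eq_exp_iff_exists_int.1 h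
      refine ⟨k, ?_⟩
      have h2 : (ω : ℂ) = ω₀ + k * (2 * Real.pi) := by
        apply mul_left_cancel₀ Complex.I_ne_zero
        rw [hk]; ring
      have h3 : (ω : ℂ) = ((ω₀ + k * (2 * Real.pi) : ℝ) : ℂ) := by rw [h2]; push_cast; rfl
      exact (Complex.ofReal_injective h3).symm
  have hfin : (P.rootSet ℂ).Finite := rootSet_finite P ℂ
  have hcount : (⋃ z ∈ P.rootSet ℂ, {ω : ℝ | circ ω = z}).Countable :=
    hfin.countable.biUnion fun z _ => hfib z
  have := hcount.measure_zero volume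
  rw [ae_iff]
  refine measure_mono_null (fun ω hω => ?_) this
  simp only [Set.mem_iUnion]
  exact ⟨circ ω, (mem_rootSet_of_ne hP).2 (not_not.1 hω), rfl⟩

theorem ae_mem_regularSubring (f : RatFunc ℝ) : ∀ᵐ ω : ℝ, f ∈ regularSubring (circ ω) :=
  ae_aeval_circ_ne_zero f.denom_ne_zero

theorem ae_forall_mem_regularSubring {ι κ : Type} [Finite ι] [Finite κ]
    (A : Matrix ι κ (RatFunc ℝ)) : ∀ᵐ ω : ℝ, ∀ a b, A a b ∈ regularSubring (circ ω) :=
  ae_all_iff.2 fun _ => ae_all_iff.2 fun _ => ae_mem_regularSubring _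

/-- Conjugation is inversion on the circle, so the conjugate of a real polynomial is again rational
in z. Reflection of coefficients makes it polynomial. -/
theorem conj_aeval_circ (P : ℝ[X]) (ω : ℝ) :
    (starRingEnd ℂ) (aeval (circ ω) P) = aeval (circ ω)⁻¹ P := by
  rw [← conj_circ]
  exact (aeval_algHom_apply Complex.conjAe.toAlgHom (circ ω) P).symm

theorem aeval_reflect {z : ℂ} (hz : z ≠ 0) {N : ℕ} {P : ℝ[X]} (hP : P.natDegree ≤ N) :
    aeval z (reflect N P) = z ^ N * aeval z⁻¹ P := by
  let _ : Invertible z⁻¹ := invertibleOfNonzero (inv_ne_zero hz)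
  have := eval₂_reflect_mul_pow (algebraMap ℝ ℂ) z⁻¹ N P hP
  rw [invOf_eq_inv, inv_inv] at this
  rw [aeval_def, aeval_def, ← this, inv_pow]
  field_simp

/-- A bounded rational function on the circle whose conjugate is also proper and without poles
outside the closed disc is constant. -/
theorem exists_eq_C_of_conj {f w : RatFunc ℝ} (hf : f ∈ outerSubring) (hw : w ∈ outerSubring)
    (hconj : ∀ᵐ ω : ℝ, RatFunc.eval (algebraMap ℝ ℂ) (circ ω) f =
      (starRingEnd ℂ) (RatFunc.eval (algebraMap ℝ ℂ) (circ ω) w))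
    (hbound : ∀ᵐ ω : ℝ, ‖RatFunc.eval (algebraMap ℝ ℂ) (circ ω) f‖ ≤ 1) :
    ∃ c, f = RatFunc.C c := by
  rw [mem_outerSubring] at hf hw
  have hproper := isProper_iff.1 hf.1
  have hwproper := isProper_iff.1 hw.1
  set N := w.denom.natDegree with hN
  have hev : ∀ (g : RatFunc ℝ) z, RatFunc.eval (algebraMap ℝ ℂ) z g =
      aeval z g.num / aeval z g.denom := fun g z => rfl
  -- On the circle f(z) = w(1/z). After clearing denominators this is an identity of polynomials,
  -- since it holds at almost all frequencies.
  have hpoly : f.num * reflect N w.denom = f.denom * reflect N w.num := by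
    by_contra hne
    have h1 := ae_aeval_circ_ne_zero (sub_ne_zero.2 hne)
    obtain ⟨ω, h1, h2, h3, h4⟩ := (h1.and (hconj.and ((ae_mem_regularSubring f).and
      (ae_mem_regularSubring w)))).exists
    have h3' : aeval (circ ω) f.denom ≠ 0 := h3
    have h4' : aeval (circ ω)⁻¹ w.denom ≠ 0 := by
      rw [← conj_aeval_circ]
      exact (_root_.map_ne_zero _).2 h4
    apply h1
    rw [hev, hev, map_div₀, conj_aeval_circ, conj_aeval_circ, div_eq_div_iff h3' h4'] at h2
    rw [map_sub, map_mul, map_mul, aeval_reflect (circ_ne_zero ω) le_rfl,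
      aeval_reflect (circ_ne_zero ω) hwproper]
    linear_combination (circ ω) ^ N * h2
  have hdvd : f.denom ∣ reflect N w.denom :=
    (RatFunc.isCoprime_num_denom f).symm.dvd_of_dvd_mul_left (Dvd.intro _ hpoly.symm)
  have hle : ∀ ω : ℝ, ‖aeval (circ ω) f.num‖ ≤ ‖aeval (circ ω) f.denom‖ := by
    have hc : ∀ P : ℝ[X], Continuous fun ω => ‖aeval (circ ω) P‖ := fun P =>
      ((Polynomial.continuous_aeval P).comp continuous_circ).norm
    have hclosed : IsClosed {ω : ℝ | ‖aeval (circ ω) f.num‖ ≤ ‖aeval (circ ω) f.denom‖} :=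
      isClosed_le (hc _) (hc _)
    have hdense : Dense {ω : ℝ | ‖aeval (circ ω) f.num‖ ≤ ‖aeval (circ ω) f.denom‖} := by
      apply Measure.dense_of_ae (μ := volume)
      filter_upwards [hbound, ae_mem_regularSubring f] with ω h1 h2
      rw [hev, norm_div] at h1
      exact (div_le_one (norm_pos_iff.2 h2)).1 h1
    intro ω
    have := hdense.closure_eq
    rw [hclosed.closure_eq] at this
    exact this.ge (Set.mem_univ ω)
  -- A pole of `f` is the inverse of a pole of `w`, so its modulus is at least one; it is also at
  -- most one. A pole on the circle would contradict the bound `hle`, as numerator and denominator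
  -- are coprime.
  have hroot : ∀ z : ℂ, aeval z f.denom ≠ 0 := by
    intro z hz
    have h1 := hf.2 z hz
    have h2 : aeval z (reflect N w.denom) = 0 := aeval_eq_zero_of_dvd_aeval_eq_zero hdvd hz
    -- The constant term of the reflected denominator is the leading coefficient 1.
    have hz0 : z ≠ 0 := by
      rintro rfl
      rw [← coeff_zero_eq_aeval_zero', coeff_reflect, revAt_le (Nat.zero_le _), Nat.sub_zero,
        hN] at h2
      have : w.denom.coeff w.denom.natDegree = 1 := RatFunc.monic_denom w
      rw [this] at h2
      simp at h2
    rw [aeval_reflect hz0 le_rfl, mul_eq_zero] at h2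
    have h3 := hw.2 _ (h2.resolve_left (pow_ne_zero _ hz0))
    rw [norm_inv] at h3
    have h4 : ‖z‖ = 1 := le_antisymm h1 ((inv_le_one₀ (norm_pos_iff.2 hz0)).1 h3)
    obtain ⟨ω, hω⟩ := (Complex.norm_eq_one_iff z).1 h4
    have hω' : circ ω = z := by rw [circ, mul_comm, hω]
    have h5 := hle ω
    rw [hω', hz, norm_zero, norm_le_zero_iff] at h5
    obtain ⟨a, b, hab⟩ := RatFunc.isCoprime_num_denom f
    have := congrArg (aeval z) hab
    simp [h5, hz] at this
  have hdeg : f.denom.natDegree = 0 := by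
    by_contra hne
    have hd : 0 < (f.denom.map (algebraMap ℝ ℂ)).degree := by
      rw [degree_map]
      exact natDegree_pos_iff_degree_pos.1 (Nat.pos_of_ne_zero hne)
    obtain ⟨z, hz⟩ := Complex.exists_root hd
    rw [IsRoot, eval_map_algebraMap] at hz
    exact hroot z hz
  rw [RatFunc.eq_C_iff]
  omega

end Circle

/-! ### Uniqueness of minimum phase spectral factors -/

section SpectralFactor

open ModelData

variable {ι : Type} [Fintype ι] [DecidableEq ι]

/-- The quotient P₀⁻¹ P₁ is unitary on the circle, hence its conjugate transpose there is its
inverse P₁⁻¹ P₀. Both are proper without poles outside the closed disc and unitary entries have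
modulus at most one, so `exists_eq_C_of_conj` applies to every entry. -/
theorem exists_eq_mul_orthogonal {P₀ P₁ : Matrix ι ι (RatFunc ℝ)}
    (h₀ : ∀ a b, P₀ a b ∈ outerSubring) (h₁ : ∀ a b, P₁ a b ∈ outerSubring)
    (h₀' : ∀ a b, P₀⁻¹ a b ∈ outerSubring) (h₁' : ∀ a b, P₁⁻¹ a b ∈ outerSubring)
    (d₀ : P₀.det ≠ 0) (d₁ : P₁.det ≠ 0)
    (hs : ∀ᵐ ω : ℝ, evalAt P₀ (circ ω) * (evalAt P₀ (circ ω)).conjTranspose =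
      evalAt P₁ (circ ω) * (evalAt P₁ (circ ω)).conjTranspose) :
    ∃ Q : Matrix ι ι ℝ, P₁ = P₀ * Q.map RatFunc.C ∧ Q * Q.transpose = 1 := by
  have i₀ : P₀⁻¹ * P₀ = 1 := Matrix.nonsing_inv_mul _ (isUnit_iff_ne_zero.2 d₀)
  have i₀' : P₀ * P₀⁻¹ = 1 := Matrix.mul_nonsing_inv _ (isUnit_iff_ne_zero.2 d₀)
  have i₁ : P₁ * P₁⁻¹ = 1 := Matrix.mul_nonsing_inv _ (isUnit_iff_ne_zero.2 d₁)
  set U := P₀⁻¹ * P₁ with hU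
  set W := P₁⁻¹ * P₀ with hW
  have hUW : U * W = 1 := by
    rw [hU, hW, Matrix.mul_assoc, ← Matrix.mul_assoc P₁, i₁, Matrix.one_mul, i₀]
  have hae : ∀ᵐ ω : ℝ, evalAt U (circ ω) * (evalAt U (circ ω)).conjTranspose = 1 ∧
      (evalAt U (circ ω)).conjTranspose = evalAt W (circ ω) := by
    filter_upwards [hs, ae_forall_mem_regularSubring P₀, ae_forall_mem_regularSubring P₁,
      ae_forall_mem_regularSubring P₀⁻¹, ae_forall_mem_regularSubring U,
      ae_forall_mem_regularSubring W] with ω h r₀ r₁ r₀' rU rW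
    have e1 : evalAt U (circ ω) = evalAt P₀⁻¹ (circ ω) * evalAt P₁ (circ ω) := evalAt_mul r₀' r₁
    have e2 : evalAt P₀⁻¹ (circ ω) * evalAt P₀ (circ ω) = 1 := by
      rw [← evalAt_mul r₀' r₀, i₀, evalAt_one]
    have e3 : evalAt U (circ ω) * evalAt W (circ ω) = 1 := by
      rw [← evalAt_mul rU rW, hUW, evalAt_one]
    have e4 : evalAt U (circ ω) * (evalAt U (circ ω)).conjTranspose = 1 := by
      rw [e1, Matrix.conjTranspose_mul, Matrix.mul_assoc, ← Matrix.mul_assoc (evalAt P₁ _), ← h,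
        ← Matrix.mul_assoc, ← Matrix.mul_assoc, e2, Matrix.one_mul, ← Matrix.conjTranspose_mul, e2,
        Matrix.conjTranspose_one]
    refine ⟨e4, ?_⟩
    have e5 := mul_eq_one_comm.1 e4
    rw [← Matrix.mul_one (evalAt U (circ ω)).conjTranspose, ← e3, ← Matrix.mul_assoc, e5,
      Matrix.one_mul]
  have hUo : ∀ a b, U a b ∈ outerSubring := mul_mem_subring _ h₀' h₁
  have hWo : ∀ a b, W a b ∈ outerSubring := mul_mem_subring _ h₁' h₀
  have hconst : ∀ a b, ∃ c, U a b = RatFunc.C c := by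
    intro a b
    refine exists_eq_C_of_conj (hUo a b) (hWo b a) ?_ ?_
    · filter_upwards [hae] with ω h
      have := congrFun (congrFun h.2 b) a
      rw [Matrix.conjTranspose_apply] at this
      change _ = (starRingEnd ℂ) (evalAt W (circ ω) b a)
      rw [← this]
      exact (star_star _).symm
    · filter_upwards [hae] with ω h
      exact entry_norm_bound_of_unitary (Matrix.mem_unitaryGroup_iff.2 h.1) a b
  choose Q hQ using hconst
  have hUQ : U = (Matrix.of Q).map RatFunc.C := by
    ext1 a b
    exact hQ a b
  refine ⟨Matrix.of Q, ?_, ?_⟩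
  · rw [← hUQ, hU, ← Matrix.mul_assoc, i₀', Matrix.one_mul]
  · obtain ⟨ω, h, -⟩ := hae.exists
    rw [hUQ, evalAt_map_C] at h
    apply Matrix.map_injective (algebraMap ℝ ℂ).injective
    have e : ((Matrix.of Q).map (algebraMap ℝ ℂ)).conjTranspose =
        (Matrix.of Q).transpose.map (algebraMap ℝ ℂ) := by
      ext a b
      simp [Matrix.conjTranspose_apply]
    rw [e] at h
    change ((Matrix.of Q) * (Matrix.of Q).transpose).map (algebraMap ℝ ℂ) = _
    rw [Matrix.map_mul, h]
    exact (Matrix.map_one _ (map_zero _) (map_one _)).symm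

open scoped MatrixOrder in
theorem exists_eq_mul_transpose {Λ : Matrix ι ι ℝ} (h : Λ.PosSemidef) (hd : Λ.det ≠ 0) :
    ∃ S : Matrix ι ι ℝ, Λ = S * S.transpose ∧ S.det ≠ 0 := by
  obtain ⟨B, rfl⟩ := CStarAlgebra.nonneg_iff_eq_star_mul_self.mp h.nonneg
  refine ⟨B.transpose, ?_, ?_⟩
  · rw [Matrix.star_eq_conjTranspose, Matrix.conjTranspose_eq_transpose_of_trivial,
      Matrix.transpose_transpose]
  · intro h0
    rw [Matrix.det_transpose] at h0
    simp [h0] at hd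

/-- Two minimum phase factors of the same spectrum differ by a constant matrix. -/
theorem exists_eq_mul_const {F₀ F₁ : Matrix ι ι (RatFunc ℝ)} {Λ₀ Λ₁ : Matrix ι ι ℝ}
    (h₀ : ∀ a b, F₀ a b ∈ outerSubring) (h₁ : ∀ a b, F₁ a b ∈ outerSubring)
    (h₀' : ∀ a b, F₀⁻¹ a b ∈ outerSubring) (h₁' : ∀ a b, F₁⁻¹ a b ∈ outerSubring)
    (d₀ : F₀.det ≠ 0) (d₁ : F₁.det ≠ 0) (p₀ : Λ₀.PosSemidef) (p₁ : Λ₁.PosSemidef)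
    (l₀ : Λ₀.det ≠ 0) (l₁ : Λ₁.det ≠ 0)
    (hs : ∀ᵐ ω : ℝ, evalAt F₀ (circ ω) * Λ₀.map (algebraMap ℝ ℂ) *
        (evalAt F₀ (circ ω)).conjTranspose =
      evalAt F₁ (circ ω) * Λ₁.map (algebraMap ℝ ℂ) * (evalAt F₁ (circ ω)).conjTranspose) :
    ∃ V : Matrix ι ι ℝ, F₁ = F₀ * V.map RatFunc.C ∧ V * Λ₁ * V.transpose = Λ₀ := by
  -- Square roots of the covariances are absorbed into the factors, which reduces the claim to
  -- identity covariance.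
  obtain ⟨S₀, rfl, s₀⟩ := exists_eq_mul_transpose p₀ l₀
  obtain ⟨S₁, rfl, s₁⟩ := exists_eq_mul_transpose p₁ l₁
  have hCmul : ∀ A B : Matrix ι ι ℝ, (A * B).map RatFunc.C = A.map RatFunc.C * B.map RatFunc.C :=
    fun A B => Matrix.map_mul
  have hCone : (1 : Matrix ι ι ℝ).map (RatFunc.C : ℝ →+* RatFunc ℝ) = 1 :=
    Matrix.map_one _ (map_zero _) (map_one _)
  have hCdet : ∀ S : Matrix ι ι ℝ, S.det ≠ 0 → (S.map (RatFunc.C : ℝ →+* RatFunc ℝ)).det ≠ 0 := by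
    intro S hS
    rw [← RingHom.mapMatrix_apply, ← RingHom.map_det]
    simpa using hS
  have hCinv : ∀ S : Matrix ι ι ℝ, S.det ≠ 0 →
      (S.map (RatFunc.C : ℝ →+* RatFunc ℝ))⁻¹ = S⁻¹.map RatFunc.C := by
    intro S hS
    apply Matrix.inv_eq_right_inv
    rw [← hCmul, Matrix.mul_nonsing_inv _ (isUnit_iff_ne_zero.2 hS), hCone]
  have hC : ∀ (S : Matrix ι ι ℝ) a b, S.map RatFunc.C a b ∈ outerSubring := fun S a b =>
    C_mem_outerSubring _
  have hev : ∀ (F : Matrix ι ι (RatFunc ℝ)) (S : Matrix ι ι ℝ), ∀ᵐ ω : ℝ,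
      evalAt (F * S.map RatFunc.C) (circ ω) *
        (evalAt (F * S.map RatFunc.C) (circ ω)).conjTranspose =
      evalAt F (circ ω) * (S * S.transpose).map (algebraMap ℝ ℂ) *
        (evalAt F (circ ω)).conjTranspose := by
    intro F S
    filter_upwards [ae_forall_mem_regularSubring F] with ω h
    rw [evalAt_mul (B := S.map RatFunc.C) h (fun a b => C_mem_regularSubring _ _), evalAt_map_C,
      Matrix.conjTranspose_mul, Matrix.map_mul, Matrix.mul_assoc, Matrix.mul_assoc,
      Matrix.mul_assoc]
    congr 3
    ext a b
    simp [Matrix.conjTranspose_apply]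
  obtain ⟨Q, hQ, hQQ⟩ := exists_eq_mul_orthogonal (P₀ := F₀ * S₀.map RatFunc.C)
    (P₁ := F₁ * S₁.map RatFunc.C) (mul_mem_subring _ h₀ (hC S₀)) (mul_mem_subring _ h₁ (hC S₁))
    (by rw [Matrix.mul_inv_rev, hCinv _ s₀]; exact mul_mem_subring _ (hC _) h₀')
    (by rw [Matrix.mul_inv_rev, hCinv _ s₁]; exact mul_mem_subring _ (hC _) h₁')
    (by rw [Matrix.det_mul]; exact mul_ne_zero d₀ (hCdet _ s₀))
    (by rw [Matrix.det_mul]; exact mul_ne_zero d₁ (hCdet _ s₁))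
    (by filter_upwards [hs, hev F₀ S₀, hev F₁ S₁] with ω h1 h2 h3; rw [h2, h3, h1])
  have e₁ : S₁ * S₁⁻¹ = 1 := Matrix.mul_nonsing_inv _ (isUnit_iff_ne_zero.2 s₁)
  have e₁' : S₁⁻¹ * S₁ = 1 := Matrix.nonsing_inv_mul _ (isUnit_iff_ne_zero.2 s₁)
  refine ⟨S₀ * Q * S₁⁻¹, ?_, ?_⟩
  · rw [hCmul, hCmul, ← Matrix.mul_assoc, ← Matrix.mul_assoc, ← hQ, Matrix.mul_assoc, ← hCmul, e₁,
      hCone, Matrix.mul_one]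
  · have e₂ : S₁.transpose * S₁⁻¹.transpose = 1 := by
      rw [← Matrix.transpose_mul, e₁', Matrix.transpose_one]
    calc S₀ * Q * S₁⁻¹ * (S₁ * S₁.transpose) * (S₀ * Q * S₁⁻¹).transpose
        = S₀ * (Q * ((S₁⁻¹ * S₁) * (S₁.transpose * S₁⁻¹.transpose)) * Q.transpose) *
            S₀.transpose := by
          simp only [Matrix.transpose_mul, Matrix.mul_assoc]
      _ = S₀ * S₀.transpose := by
          rw [e₁', e₂, Matrix.one_mul, Matrix.mul_one, hQQ, Matrix.mul_one]

end SpectralFactor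

/-! ### The spectral factor `C T H` of the measured spectrum -/

namespace ModelData

variable {L K n : ℕ} {M : ModelData L K n}

theorem mem_outerSubring_of_isStable {f : RatFunc ℝ} (hf : IsProper f) (hs : IsStable f) :
    f ∈ outerSubring :=
  mem_outerSubring.2 ⟨hf, fun z hz => (hs z hz).le⟩

theorem mem_regularSubring_of_isStable {f : RatFunc ℝ} (hs : IsStable f) (ω : ℝ) :
    f ∈ regularSubring (circ ω) := by
  intro h
  have := hs _ h
  rw [norm_circ] at this
  exact lt_irrefl _ this

theorem H_mem (S : Subring (RatFunc ℝ)) {θ : Fin n → ℝ} (h : ∀ a b, M.Htilde θ a b ∈ S) (a b) :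
    M.H θ a b ∈ S := by
  simp only [H, Matrix.of_apply]
  split_ifs
  · exact h _ _
  · exact S.zero_mem

theorem CTH_mem (S : Subring (RatFunc ℝ)) {θ : Fin n → ℝ} (hT : ∀ a b, M.T θ a b ∈ S)
    (h : ∀ a b, M.Htilde θ a b ∈ S) (a b) : M.CTH θ a b ∈ S :=
  mul_mem_subring S hT (H_mem S h) _ _

/-- Stability keeps all poles off the unit circle, so evaluation is multiplicative at every
frequency. -/
theorem measuredSpectrum_eq (hM : M.IsModelSet) {θ : Fin n → ℝ} (hθ : θ ∈ M.Θ) (ω : ℝ) :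
    M.measuredSpectrum θ ω = evalAt (M.CTH θ) (circ ω) * (M.Λ θ).map (algebraMap ℝ ℂ) *
      (evalAt (M.CTH θ) (circ ω)).conjTranspose := by
  have hT : ∀ a b, M.T θ a b ∈ regularSubring (circ ω) := fun a b =>
    mem_regularSubring_of_isStable (hM.stable_T θ hθ a b) ω
  have hH : ∀ a b, M.H θ a b ∈ regularSubring (circ ω) :=
    H_mem _ fun a b => mem_regularSubring_of_isStable (hM.stable_H θ hθ a b) ω
  have e : evalAt (M.CTH θ) (circ ω) =
      (evalAt (M.T θ) (circ ω) * evalAt (M.H θ) (circ ω)).submatrix Subtype.val id := by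
    rw [← evalAt_mul hT hH]
    rfl
  rw [e, measuredSpectrum, spectrum, Matrix.mul_assoc _ _ (evalAt (M.T θ) (circ ω)).conjTranspose,
    ← Matrix.conjTranspose_mul]
  rfl

/-- The rank of the spectrum is at most that of the covariance matrix; one frequency of full rank
suffices. -/
theorem det_Λ_ne_zero (hM : M.IsModelSet) (hrank : M.FullRankSpectrum) {θ : Fin n → ℝ}
    (hθ : θ ∈ M.Θ) : (M.Λ θ).det ≠ 0 := by
  obtain ⟨ω, hω⟩ := (hrank θ hθ).exists
  rw [measuredSpectrum_eq hM hθ] at hω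
  have h1 := ((Matrix.rank_mul_le _ _).trans (min_le_left _ _)).trans
    ((Matrix.rank_mul_le (evalAt (M.CTH θ) (circ ω)) ((M.Λ θ).map (algebraMap ℝ ℂ))).trans
      (min_le_right _ _)) |> hω.ge.trans
  have h2 := det_ne_zero_of_rank_eq_card
    (le_antisymm (Matrix.rank_le_card_height _) (by rwa [Fintype.card_coe]))
  rw [← RingHom.mapMatrix_apply, ← RingHom.map_det] at h2
  simpa using h2

/-- `T^∞`, the limit of `T` at infinity. -/
theorem map_limInf_T (hM : M.IsModelSet) {θ : Fin n → ℝ} (hθ : θ ∈ M.Θ) :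
    (1 - M.Ginf θ) * (M.T θ).map limInf = 1 := by
  rw [← map_limInf_one_sub_G hM hθ, ← map_limInf_mul (one_sub_G_mem hM hθ) (T_mem hM hθ),
    one_sub_G_mul_T hM hθ, map_limInf_one]

theorem map_limInf_CTH (hM : M.IsModelSet) {θ : Fin n → ℝ} (hθ : θ ∈ M.Θ) :
    (M.CTH θ).map limInf = ((M.T θ).map limInf).submatrix Subtype.val Subtype.val := by
  have e : (M.CTH θ).map limInf = ((M.T θ * M.H θ).map limInf).submatrix Subtype.val id := rfl
  rw [e, map_limInf_mul (T_mem hM hθ) (H_mem _ (hM.proper_H θ hθ))]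
  have hH : (M.H θ).map limInf = Matrix.of fun a (c : M.C) => if a = c.1 then (1 : ℝ) else 0 := by
    ext a c
    simp only [Matrix.map_apply, H, Matrix.of_apply]
    split_ifs with h1 h2 h2
    · have := congrFun (congrFun (hM.monic_H θ hθ) ⟨a, h1⟩) c
      rw [Matrix.map_apply] at this
      rw [this]
      simp [Matrix.one_apply, h2]
    · have := congrFun (congrFun (hM.monic_H θ hθ) ⟨a, h1⟩) c
      rw [Matrix.map_apply] at this
      rw [this]
      simp [Subtype.ext_iff, h2]
    · exact absurd (h2 ▸ c.2) h1
    · exact map_zero limInfHom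
  rw [hH]
  ext a c
  simp [Matrix.mul_apply]

/-- As `H̃` is monic, the limit of `C T H` is a principal block of the limit of T. It is
complementary to a principal minor of 1 - G at infinity, which is nonzero. This makes the inverse of
`C T H` proper. -/
theorem det_map_limInf_CTH_ne_zero (hM : M.IsModelSet) {θ : Fin n → ℝ} (hθ : θ ∈ M.Θ) :
    ((M.CTH θ).map limInf).det ≠ 0 := by
  classical
  intro h0
  obtain ⟨v, hv, hv0⟩ := Matrix.exists_mulVec_eq_zero_iff.2 h0
  apply hv
  rw [map_limInf_CTH hM hθ] at hv0
  have := eq_zero_of_complementary_minor (map_limInf_T hM hθ) 1 (M.C : Set (Fin L))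
    (Finset.univ.filter (· ∉ M.C)) (by simp) (hM.wellPosed θ hθ _)
    (fun a => if h : a ∈ M.C then v ⟨a, h⟩ else 0) (fun b hb => dif_neg hb) (fun q hq => by
      refine Eq.trans ?_ (congrFun hv0 ⟨q, hq⟩)
      rw [← Finset.sum_subset (Finset.subset_univ M.C) (fun c _ hc => by simp [hc]),
        ← Finset.sum_coe_sort M.C]
      refine Finset.sum_congr rfl fun c _ => ?_
      simp)
  funext c
  have h := congrFun this c.1
  simpa using h

/-- The minimum phase factors `C T H` of equal spectra coincide. -/
theorem CTH_eq (hM : M.IsModelSet) (hrank : M.FullRankSpectrum) (hfeed : M.FeedthroughCondition)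
    (hmin : M.MinPhaseFactor) {θ₀ θ₁ : Fin n → ℝ} (hθ₀ : θ₀ ∈ M.Θ) (hθ₁ : θ₁ ∈ M.Θ)
    (hs : ∀ ω : ℝ, M.measuredSpectrum θ₀ ω = M.measuredSpectrum θ₁ ω) : M.CTH θ₀ = M.CTH θ₁ := by
  have hout : ∀ θ ∈ M.Θ, ∀ a b, M.CTH θ a b ∈ outerSubring := fun θ hθ =>
    CTH_mem _ (fun a b => mem_outerSubring_of_isStable (T_mem hM hθ a b) (hM.stable_T θ hθ a b))
      fun a b => mem_outerSubring_of_isStable (hM.proper_H θ hθ a b) (hM.stable_H θ hθ a b)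
  have hproper : ∀ θ ∈ M.Θ, ∀ a b, M.CTH θ a b ∈ properSubring := fun θ hθ a b =>
    (mem_outerSubring.1 (hout θ hθ a b)).1
  have hinv : ∀ θ ∈ M.Θ, ∀ a b, (M.CTH θ)⁻¹ a b ∈ outerSubring := fun θ hθ a b =>
    mem_outerSubring.2 ⟨inv_mem_properSubring (hproper θ hθ) (det_map_limInf_CTH_ne_zero hM hθ) a b,
      (hmin θ hθ).2 a b⟩
  obtain ⟨V, hV, hVΛ⟩ := exists_eq_mul_const (hout _ hθ₀) (hout _ hθ₁) (hinv _ hθ₀) (hinv _ hθ₁)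
    (hmin _ hθ₀).1 (hmin _ hθ₁).1 (hM.posSemidef _ hθ₀) (hM.posSemidef _ hθ₁)
    (det_Λ_ne_zero hM hrank hθ₀) (det_Λ_ne_zero hM hrank hθ₁) (Filter.Eventually.of_forall fun ω => by
      rw [← measuredSpectrum_eq hM hθ₀, ← measuredSpectrum_eq hM hθ₁, hs])
  have hVinf : (M.CTH θ₁).map limInf = (M.CTH θ₀).map limInf * V := by
    rw [hV, map_limInf_mul (B := V.map RatFunc.C) (hproper _ hθ₀) (fun a b => isProper_C _)]
    congr 1
    ext a b
    simp [limInf_C]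
  suffices V = 1 by
    rw [hV, this, Matrix.map_one _ (map_zero _) (map_one _), Matrix.mul_one]
  rcases hfeed with hstrict | ⟨hdiag, σ, hσ⟩
  · have hone : ∀ θ ∈ M.Θ, (M.CTH θ).map limInf = 1 := by
      intro θ hθ
      have hG : M.Ginf θ = 0 := by
        ext a b
        rcases hstrict θ hθ a b with h | h
        · rw [Ginf, Matrix.map_apply, h]
          exact map_zero limInfHom
        · rw [Ginf, Matrix.map_apply, Matrix.zero_apply, limInf]
          apply coeff_eq_zero_of_natDegree_lt
          rw [RatFunc.intDegree] at h
          omega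
      have hT := map_limInf_T hM hθ
      rw [hG, sub_zero, Matrix.one_mul] at hT
      rw [map_limInf_CTH hM hθ, hT]
      exact Matrix.submatrix_one _ Subtype.val_injective
    rw [hone _ hθ₀, hone _ hθ₁, Matrix.one_mul] at hVinf
    exact hVinf.symm
  · have hGdiag : ∀ θ ∈ M.Θ, ∀ a, M.Ginf θ a a = 0 := by
      intro θ hθ a
      rw [Ginf, Matrix.map_apply, hM.hollow_G θ hθ]
      exact map_zero limInfHom
    have hGtri : ∀ θ ∈ M.Θ, ∀ a b, σ.symm a < σ.symm b → M.Ginf θ a b = 0 := by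
      intro θ hθ a b hab
      have := hσ θ hθ _ _ hab
      rwa [σ.apply_symm_apply, σ.apply_symm_apply] at this
    have hTtri : ∀ θ ∈ M.Θ, ∀ a b, σ.symm a < σ.symm b → (M.T θ).map limInf a b = 0 := by
      intro θ hθ a b hab
      have hT := map_limInf_T hM hθ
      have : Invertible (1 - M.Ginf θ) :=
        Matrix.invertibleOfIsUnitDet _ (isUnit_iff_ne_zero.2 (det_one_sub_Ginf_ne_zero hM hθ))
      -- `BlockTriangular` means upper triangular, so the order given by `σ` is reversed.
      have htri : (1 - M.Ginf θ).BlockTriangular (fun a => OrderDual.toDual (σ.symm a)) := by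
        intro a b hab
        rw [OrderDual.toDual_lt_toDual] at hab
        have hne : a ≠ b := by rintro rfl; exact lt_irrefl _ hab
        rw [Matrix.sub_apply, Matrix.one_apply_ne hne, hGtri θ hθ a b hab, sub_zero]
      rw [← Matrix.inv_eq_right_inv hT]
      exact Matrix.blockTriangular_inv_of_blockTriangular htri (OrderDual.toDual_lt_toDual.2 hab)
    have hTdiag : ∀ θ ∈ M.Θ, ∀ a, (M.T θ).map limInf a a = 1 := by
      intro θ hθ a
      have hT' := mul_eq_one_comm.1 (map_limInf_T hM hθ)
      have hT := congrFun (congrFun hT' a) a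
      rw [Matrix.mul_sub, Matrix.mul_one, Matrix.sub_apply, Matrix.mul_apply,
        Finset.sum_eq_zero, sub_zero, Matrix.one_apply_eq] at hT
      · exact hT
      · intro b _
        rcases lt_trichotomy (σ.symm a) (σ.symm b) with h | h | h
        · rw [hTtri θ hθ a b h, zero_mul]
        · rw [σ.symm.injective h, hGdiag θ hθ, mul_zero]
        · rw [hGtri θ hθ b a h, mul_zero]
    set f : M.C → (Fin L)ᵒᵈ := fun a => OrderDual.toDual (σ.symm a) with hf
    have hFtri : ∀ θ ∈ M.Θ, ((M.CTH θ).map limInf).BlockTriangular f := by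
      intro θ hθ a b hab
      rw [map_limInf_CTH hM hθ]
      exact hTtri θ hθ _ _ (OrderDual.toDual_lt_toDual.1 hab)
    have hFdiag : ∀ θ ∈ M.Θ, ∀ a, (M.CTH θ).map limInf a a = 1 := by
      intro θ hθ a
      rw [map_limInf_CTH hM hθ]
      exact hTdiag θ hθ _
    have hVtri : V.BlockTriangular f := by
      have : Invertible ((M.CTH θ₀).map limInf) := Matrix.invertibleOfIsUnitDet _
        (isUnit_iff_ne_zero.2 (det_map_limInf_CTH_ne_zero hM hθ₀))
      have e : V = ((M.CTH θ₀).map limInf)⁻¹ * (M.CTH θ₁).map limInf := by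
        rw [hVinf, ← Matrix.mul_assoc, Matrix.inv_mul_of_invertible, Matrix.one_mul]
      rw [e]
      exact (Matrix.blockTriangular_inv_of_blockTriangular (hFtri _ hθ₀)).mul (hFtri _ hθ₁)
    have hVdet : V.det ≠ 0 := by
      intro h0
      apply det_Λ_ne_zero hM hrank hθ₀
      rw [← hVΛ, Matrix.det_mul, Matrix.det_mul, h0, zero_mul, zero_mul]
    -- With diagonal covariances the left side is triangular in one direction and the right side in
    -- the other, so V is diagonal. The unit diagonals of the two limits then give V = 1.
    have hVinv : V * M.Λ θ₁ = M.Λ θ₀ * V⁻¹.transpose := by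
      rw [← hVΛ, Matrix.mul_assoc _ V.transpose, ← Matrix.transpose_mul,
        Matrix.nonsing_inv_mul _ (isUnit_iff_ne_zero.2 hVdet), Matrix.transpose_one, Matrix.mul_one]
    have hΛ : ∀ θ ∈ M.Θ, M.Λ θ = Matrix.diagonal (M.Λ θ).diag := fun θ hθ =>
      (hdiag θ hθ).diagonal_diag.symm
    have hVinvtri : V⁻¹.BlockTriangular f := by
      have : Invertible V := Matrix.invertibleOfIsUnitDet _ (isUnit_iff_ne_zero.2 hVdet)
      exact Matrix.blockTriangular_inv_of_blockTriangular hVtri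
    have hVzero : ∀ a b, a ≠ b → V a b = 0 := by
      intro a b hab
      rcases lt_trichotomy (f a) (f b) with h | h | h
      · have e := congrFun (congrFun hVinv a) b
        rw [hΛ _ hθ₀, hΛ _ hθ₁, Matrix.mul_diagonal, Matrix.diagonal_mul, Matrix.transpose_apply,
          hVinvtri h, mul_zero] at e
        refine (mul_eq_zero.1 e).resolve_right fun h0 => det_Λ_ne_zero hM hrank hθ₁ ?_
        rw [hΛ _ hθ₁, Matrix.det_diagonal]
        exact Finset.prod_eq_zero (Finset.mem_univ b) h0
      · exact absurd (Subtype.ext (σ.symm.injective h)) hab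
      · exact hVtri h
    ext a b
    by_cases hab : a = b
    · subst hab
      have e := congrFun (congrFun hVinf a) a
      rw [hFdiag _ hθ₁, Matrix.mul_apply, Finset.sum_eq_single a, hFdiag _ hθ₀, one_mul] at e
      · rw [← e, Matrix.one_apply_eq]
      · intro b _ hb
        rw [hVzero b a hb, mul_zero]
      · simp
    · rw [hVzero a b hab, Matrix.one_apply_ne hab]

end ModelData

namespace ModelData

variable {L K n : ℕ} {M : ModelData L K n}

/-! ### Identifiability in the four cases -/

/-- The graph of the internal signals. -/
def InternalEdge (M : ModelData L K n) (a b : Fin L) : Prop :=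
  M.Edge (internal a) (internal b)

theorem internalEdge_of_ne_zero {θ : Fin n → ℝ} (hθ : θ ∈ M.Θ) (a b : Fin L)
    (h : M.G θ b a ≠ 0) : M.InternalEdge a b :=
  fun h0 => h (h0 θ hθ)

theorem IsPath.map_internal {a b : Fin L} {p : List (Fin L)} (h : IsPath M.InternalEdge a b p) :
    IsPath M.Edge (internal a) (internal b) (p.map internal) := by
  obtain ⟨h1, h2, h3, h4⟩ := h
  refine ⟨by simp [h1], by simp [h2], ?_, h4.map Sum.inl_injective⟩
  rw [List.isChain_map]
  exact h3

/-- No edge enters an external signal, so after its first vertex a path is internal. Paths between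
internal signals can therefore be handled in the internal graph. -/
theorem exists_eq_map_internal {v : Vertex L K M.C} {p : List (Vertex L K M.C)}
    (h : (v :: p).IsChain M.Edge) : ∃ q : List (Fin L), p = q.map internal := by
  induction p generalizing v with
  | nil => exact ⟨[], rfl⟩
  | cons u p ih =>
    rw [List.isChain_cons_cons] at h
    obtain ⟨q, rfl⟩ := ih h.2
    rcases u with u | u
    · exact ⟨u :: q, rfl⟩
    · exact absurd h.1 (fun h => h)

theorem exists_isPath_of_pathAvoiding {D : Set (Fin L)} {a b : Fin L}
    (h : M.PathAvoiding D a b) : ∃ p, IsPath M.InternalEdge a b p ∧ ∀ d ∈ D, d ∉ p := by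
  obtain ⟨p, ⟨h1, h2, h3, h4⟩, hD⟩ := h
  obtain ⟨q, rfl⟩ : ∃ q : List (Fin L), p = q.map internal := by
    cases p with
    | nil => exact ⟨[], rfl⟩
    | cons v p =>
      obtain ⟨q, rfl⟩ := exists_eq_map_internal h3
      simp only [List.head?_cons, Option.some.injEq] at h1
      exact ⟨a :: q, by rw [h1, List.map_cons]⟩
  refine ⟨q, ⟨?_, ?_, ?_, h4.of_map _⟩, fun d hd hdq => hD d hd (List.mem_map_of_mem hdq)⟩
  · rw [List.head?_map] at h1
    exact Option.map_injective Sum.inl_injective h1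
  · rw [List.getLast?_map] at h2
    exact Option.map_injective Sum.inl_injective h2
  · rw [List.isChain_map] at h3
    exact h3

theorem Disconnects.isDisconnecting {D A B : Set (Fin L)} (h : M.Disconnects D A B) :
    IsDisconnecting M.InternalEdge D A B := by
  intro a ha b hb p hp
  obtain ⟨_, ⟨d, hd, rfl⟩, hdp⟩ := h _ ⟨a, ha, rfl⟩ _ ⟨b, hb, rfl⟩ _ (IsPath.map_internal hp)
  obtain ⟨d', hd', h'⟩ := List.mem_map.1 hdp
  exact ⟨d, hd, Sum.inl_injective h' ▸ hd'⟩

/-- The entries of `T` in measured rows and excited columns are determined by `C T R`. -/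
theorem T_eq_of_CTR_eq {θ₀ θ₁ : Fin n → ℝ} (h : M.CTR θ₀ = M.CTR θ₁) {a b : Fin L} (ha : a ∈ M.C)
    (hb : M.ExcitedByR b) : M.T θ₀ a b = M.T θ₁ a b := by
  obtain ⟨p, rfl⟩ := hb
  have e : ∀ θ, M.CTR θ ⟨a, ha⟩ p = M.T θ a (M.ρ p) := by
    intro θ
    change (M.T θ * M.R) a p = _
    simp [Matrix.mul_apply, R]
  rw [← e, ← e, h]

theorem known_internal {a b : Fin L} (h : M.Known (internal a) b) {θ θ' : Fin n → ℝ}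
    (hθ : θ ∈ M.Θ) (hθ' : θ' ∈ M.Θ) : M.G θ b a = M.G θ' b a :=
  h θ hθ θ' hθ'

theorem G_eq_zero_of_not_edge {a b : Fin L} (h : ¬ M.Edge (internal a) (internal b))
    {θ : Fin n → ℝ} (hθ : θ ∈ M.Θ) : M.G θ b a = 0 :=
  not_not.1 h θ hθ

/-- Columns of `C T` that belong to signals with a clean excitation are determined by the data. -/
theorem T_eq_of_cleanExcitation {θ₀ θ₁ : Fin n → ℝ} (hθ₀ : θ₀ ∈ M.Θ) (hθ₁ : θ₁ ∈ M.Θ)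
    (hCTR : M.CTR θ₀ = M.CTR θ₁) {a b : Fin L} (ha : a ∈ M.C)
    (hCTH : ¬ M.ExcitedByR b → M.CTH θ₀ = M.CTH θ₁) {x : Fin K ⊕ M.C}
    (hx : M.CleanExcitation x b) : M.T θ₀ a b = M.T θ₁ a b := by
  by_cases hb : M.ExcitedByR b
  · exact T_eq_of_CTR_eq hCTR ha hb
  obtain ⟨hedge, hdeg, hknown⟩ := hx
  rcases x with p | c
  · exfalso
    apply hedge
    intro θ _
    change M.R b p = 0
    simp only [R, Matrix.of_apply]
    rw [if_neg fun h => hb ⟨p, h⟩]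
  -- Out-degree one leaves a single nonzero entry in column `c` of H, at row `b`. Column `c` of `C T
  -- H` is thus column `b` of `C T` times a known nonzero factor, which cancels.
  · have hzero : ∀ θ ∈ M.Θ, ∀ b', b' ≠ b → M.H θ b' c = 0 := by
      obtain ⟨u, hu⟩ := Set.ncard_eq_one.1 hdeg
      have hbu : internal b = u := by
        have : (internal b : Vertex L K M.C) ∈ ({u} : Set (Vertex L K M.C)) := hu ▸ hedge
        exact this
      intro θ hθ b' hb'
      by_contra hne
      have : (internal b' : Vertex L K M.C) ∈ ({u} : Set (Vertex L K M.C)) :=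
        hu ▸ fun h0 => hne (h0 θ hθ)
      rw [← hbu] at this
      exact hb' (Sum.inl_injective this)
    have e : ∀ θ ∈ M.Θ, M.CTH θ ⟨a, ha⟩ c = M.T θ a b * M.H θ b c := by
      intro θ hθ
      change (M.T θ * M.H θ) a c = _
      rw [Matrix.mul_apply]
      exact Finset.sum_eq_single b (fun b' _ hb' => by rw [hzero θ hθ b' hb', mul_zero]) (by simp)
    have hH : M.H θ₀ b c = M.H θ₁ b c := hknown θ₀ hθ₀ θ₁ hθ₁
    have hne : M.H θ₀ b c ≠ 0 := by
      intro h0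
      apply hedge
      intro θ hθ
      exact (hknown θ hθ θ₀ hθ₀).trans h0
    have := e θ₀ hθ₀
    rw [hCTH hb, e θ₁ hθ₁, hH] at this
    exact (mul_right_cancel₀ (hH ▸ hne) this).symm

variable {j i : Fin L} {D : Set (Fin L)}

/-- No parameter value is exceptional here, since only principal minors occur. An in-neighbor left
out of `Nminus` is measured and has a known edge, so its term in row `j` is determined by the data.
-/
theorem Case1.genericallyIdentifiable (hM : M.IsModelSet) (h : M.Case1 j i D) :
    M.GenericallyIdentifiable j i := by
  refine Filter.Eventually.of_forall fun θ₀ hθ₀ θ₁ hθ₁ hCTR _ => ?_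
  have hΘ : ∀ k : Bool, cond k θ₀ θ₁ ∈ M.Θ := fun k => by cases k <;> assumption
  refine entry_eq_of_rows (G := fun k => M.G (cond k θ₀ θ₁)) (T := fun k => M.T (cond k θ₀ θ₁))
    (fun k => one_sub_G_mul_T hM (hΘ k)) (fun k => T_mul_one_sub_G hM (hΘ k))
    (fun k => principalMinorsNeZero hM (hΘ k)) (fun k => internalEdge_of_ne_zero (hΘ k))
    h.not_mem h.disconnects.isDisconnecting
    (fun q hq a ha => T_eq_of_CTR_eq hCTR (h.measure a ha) (h.excite q hq)) ?_
  intro q hq a hai ha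
  by_cases he : M.Edge (internal a) (internal j)
  · have hk : a ∈ M.C ∧ M.Known (internal a) j := by
      by_contra hk
      exact ha ⟨⟨he, hk⟩, hai⟩
    change M.G θ₀ j a * M.T θ₀ a q = M.G θ₁ j a * M.T θ₁ a q
    rw [known_internal hk.2 hθ₀ hθ₁, T_eq_of_CTR_eq hCTR hk.1 (h.excite q hq)]
  · change M.G θ₀ j a * M.T θ₀ a q = M.G θ₁ j a * M.T θ₁ a q
    rw [G_eq_zero_of_not_edge he hθ₀, G_eq_zero_of_not_edge he hθ₁, zero_mul, zero_mul]

theorem Case3.genericallyIdentifiable (hM : M.IsModelSet) (h : M.Case3 j i D) :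
    M.GenericallyIdentifiable j i := by
  refine Filter.Eventually.of_forall fun θ₀ hθ₀ θ₁ hθ₁ hCTR _ => ?_
  have hΘ : ∀ k : Bool, cond k θ₀ θ₁ ∈ M.Θ := fun k => by cases k <;> assumption
  refine entry_eq_of_rows_of_predecessors (G := fun k => M.G (cond k θ₀ θ₁))
    (T := fun k => M.T (cond k θ₀ θ₁))
    (fun k => one_sub_G_mul_T hM (hΘ k)) (fun k => T_mul_one_sub_G hM (hΘ k))
    (fun k => principalMinorsNeZero hM (hΘ k)) (fun k => internalEdge_of_ne_zero (hΘ k))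
    (fun k => hM.hollow_G _ (hΘ k))
    h.not_mem h.disconnects.isDisconnecting
    (fun q hq a ha => T_eq_of_CTR_eq hCTR (h.measure a ha) (h.excite q hq)) ?_
  intro q hq a hai ha
  change M.G θ₀ j a * M.T θ₀ a q = M.G θ₁ j a * M.T θ₁ a q
  by_cases he : M.Edge (internal a) (internal j)
  · have hk : a ∈ M.C ∧ M.Known (internal a) j := by
      by_contra hk
      exact ha ⟨⟨he, hk⟩, hai⟩
    rw [known_internal hk.2 hθ₀ hθ₁, T_eq_of_CTR_eq hCTR hk.1 (h.excite q hq)]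
  · rw [G_eq_zero_of_not_edge he hθ₀, G_eq_zero_of_not_edge he hθ₁, zero_mul, zero_mul]

theorem Case2.genericallyIdentifiable (hM : M.IsModelSet) (hrank : M.FullRankSpectrum)
    (hindep : M.IndependentlyParameterized) (hfeed : M.FeedthroughCondition)
    (hfixed : M.FixedEntriesRegular) (h : M.Case2 j i D)
    (hmin : M.ReliesOnNoise i → M.MinPhaseFactor) : M.GenericallyIdentifiable j i := by
  classical
  -- A direct measurement of `w_j` is treated as the indirect one with l = j and the one-vertex
  -- path.
  obtain ⟨l, hl, hdisc, p, hp, hpD⟩ : ∃ l ∈ M.C, M.Disconnects D (M.Nplus i \ {j}) {l} ∧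
      ∃ p, IsPath M.InternalEdge j l p ∧ ∀ d ∈ D, d ∉ p := by
    rcases h.output with hj | ⟨l, hl, -, hdisc, hpath⟩
    · refine ⟨j, hj, h.disconnects, [j], IsPath.single j, fun d hd hdj => h.not_mem ?_⟩
      rw [List.mem_singleton] at hdj
      exact hdj ▸ hd
    · exact ⟨l, hl, hdisc, exists_isPath_of_pathAvoiding hpath⟩
  -- The inverse of this cycle sends `j` to `l`, fixes D because the path avoids it, and matches
  -- every other row with itself or with an in-neighbor, which is a perfect matching of 1 - G
  -- outside D ∪ {j}.
  obtain ⟨π, hπl, hπ, hπp, -⟩ := hp.exists_perm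
  have hgen := ae_det_submatrix_ne_zero hM hindep hfixed
    (Finset.univ.filter fun a => a ∉ D ∪ {j}) π⁻¹ (by
      intro a ha
      have ha : a ∉ D ∪ {j} := by simpa using ha
      have hne : π⁻¹ a ≠ l := by
        intro h
        rw [Equiv.Perm.inv_eq_iff_eq, hπl] at h
        exact ha (Or.inr h)
      have hinv : π (π⁻¹ a) = a := π.apply_symm_apply a
      rcases hπ _ hne with h | h
      · left
        rw [hinv] at h
        exact h.symm
      · right
        rw [hinv] at h
        exact h)
  filter_upwards [hgen] with θ₀ hdet hθ₀ θ₁ hθ₁ hCTR hspec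
  have hΘ : ∀ k : Bool, cond k θ₀ θ₁ ∈ M.Θ := fun k => by cases k <;> assumption
  have hmeas : ∀ q ∈ D ∪ {l}, q ∈ M.C := by
    rintro q (hq | hq)
    · exact h.measure q hq
    · exact (Set.mem_singleton_iff.1 hq) ▸ hl
  refine entry_eq_of_columns (G := fun k => M.G (cond k θ₀ θ₁)) (T := fun k => M.T (cond k θ₀ θ₁))
    (fun k => one_sub_G_mul_T hM (hΘ k)) (fun k => T_mul_one_sub_G hM (hΘ k))
    (fun k => principalMinorsNeZero hM (hΘ k)) (fun k => internalEdge_of_ne_zero (hΘ k))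
    h.not_mem hdisc.isDisconnecting π⁻¹ (Equiv.Perm.inv_eq_iff_eq.2 hπl.symm)
    (fun d hd => Equiv.Perm.inv_eq_iff_eq.2 (hπp d (hpD d hd)).symm) _ (by simp) (hdet hθ₀)
    (fun q hq a ha => T_eq_of_CTR_eq hCTR (hmeas q hq) (h.excite a ha)) ?_
  intro q hq a haj ha
  change M.G θ₀ a i * M.T θ₀ q a = M.G θ₁ a i * M.T θ₁ q a
  by_cases he : M.Edge (internal i) (internal a)
  · have hnot : a ∉ M.Nplus i := fun hn => ha ⟨hn, haj⟩
    -- An out-neighbor left out of `Nplus` has a known edge and a clean excitation, so both factors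
    -- agree; equality of the factors `C T H` is needed only if no signal in `r` excites it.
    obtain ⟨hk, x, hx⟩ : M.Known (internal i) a ∧ ∃ x, M.CleanExcitation x a := by
      by_contra hk
      exact hnot ⟨he, hk⟩
    rw [known_internal hk hθ₀ hθ₁, T_eq_of_cleanExcitation hθ₀ hθ₁ hCTR (hmeas q hq)
      (fun hr => CTH_eq hM hrank hfeed (hmin ⟨a, he, hnot, hr⟩) hθ₀ hθ₁ hspec) hx]
  · rw [G_eq_zero_of_not_edge he hθ₀, G_eq_zero_of_not_edge he hθ₁, zero_mul, zero_mul]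

/-- In Case 4 the signal `w_i` belongs to `D`, so that Case 4 is an instance of Case 2. -/
theorem Case4.case2 (h : M.Case4 j i D) : M.Case2 j i D := by
  -- The one-vertex path at `i` starts and ends in the separated sets, so D must contain `i`.
  have hi : i ∈ D := by
    obtain ⟨_, ⟨d, hd, rfl⟩, hdp⟩ := h.disconnects _ ⟨i, Or.inr rfl, rfl⟩ _ ⟨i, Or.inl rfl, rfl⟩ _
      (IsPath.single _)
    rw [List.mem_singleton] at hdp
    exact Sum.inl_injective hdp ▸ hd
  refine ⟨h.not_mem, fun a ha b hb => h.disconnects a (Set.image_mono Set.subset_union_left ha) b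
    (Set.image_mono (by simp) hb), ?_, h.measure, Or.inr ?_⟩
  · rintro a (ha | rfl | rfl)
    · exact h.excite a (Or.inl ha)
    · exact h.excite _ (Or.inl hi)
    · exact h.excite _ (Or.inr rfl)
  · obtain ⟨k, hk, hkj, hdisc, hpath⟩ := h.output
    exact ⟨k, hk, hkj, fun a ha b hb => hdisc a (Set.image_mono Set.subset_union_left ha) b hb,
      hpath⟩

end ModelData

end DynNet

end
theorem mainTheorem7 {L K n : ℕ} (M : DynNet.ModelData L K n) (hM : M.IsModelSet)
    (hrank : M.FullRankSpectrum) (hindep : M.IndependentlyParameterized)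
    (hfeed : M.FeedthroughCondition) (hfixed : M.FixedEntriesRegular)
    (j i : Fin L) (D : Set (Fin L)) :
    (M.Case1 j i D → M.GenericallyIdentifiable j i) ∧
    (M.Case2 j i D → (M.ReliesOnNoise i → M.MinPhaseFactor) →
      M.GenericallyIdentifiable j i) ∧
    (M.Case3 j i D → M.GenericallyIdentifiable j i) ∧
    (M.Case4 j i D → (M.ReliesOnNoise i → M.MinPhaseFactor) →
      M.GenericallyIdentifiable j i) :=
  ⟨fun h => h.genericallyIdentifiable hM,
    fun h hmin => h.genericallyIdentifiable hM hrank hindep hfeed hfixed hmin,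
    fun h => h.genericallyIdentifiable hM,
    fun h hmin => h.case2.genericallyIdentifiable hM hrank hindep hfeed hfixed hmin⟩
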